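/- Let $t_0<t_f$, $I=(t_0,t_f)$, and let $\mathcal G^2$ be the space of functions $g:I\times\mathbb R^{n_x}\to\mathbb R^{n_g}$ such that $g(t,\cdot)$ is twice continuously differentiable for a.a. $t\in I$, $g(\cdot,x)$ is measurable for each $x$, and $$\|g\|_{\mathcal G^2}=\sum_{n=0}^{2}\operatorname*{ess\,sup}_{t\in I}\,\sup_{x\in\mathbb R^{n_x}}\|g^{(n)}(t,x)\|<\infty ,$$ where $g^{(n)}$ is the $n$-th derivative with respect to $x$ (functions that agree for a.a. $t$ and all $x$ are at distance $0$). Say that $h:I\times\mathbb R^{n_x}\times\mathbb R^{n_g}\to\mathbb R^m$ is *admissible* if (a) for a.a. $t$ it is continuously differentiable in $(x,g)$, and it is measurable in $t$ for each $(x,g)$; (b) there is $K>0$ such that $\|h(t,0,g)\|$, $\|h_x(t,0,g)\|$ and $\|h_g(t,0,g)\|$ are at most $K(\|g\|+1)$ for a.a. $t$ and all $g$; (c) for every $R>0$ there is $L(R)$ such that, for a.a. $t$ and all $x_1,x_2,g_1,g_2$ of norm at most $R$, $$\|h(t,x_1,g_1)-h(t,x_2,g_2)\|\le L(R)\,(\|x_1-x_2\|+\|g_1-g_2\|),$$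 $$\|h_x(t,x_1,g_1)-h_x(t,x_2,g_2)\|+\|h_g(t,x_1,g_1)-h_g(t,x_2,g_2)\|\le L(R)\,(\|x_1-x_2\|+\|g_1-g_2\|).$$ Let $f:I\times\mathbb R^{n_x}\times\mathbb R^{n_g}\to\mathbb R^{n_x}$ and $l:I\times\mathbb R^{n_x}\times\mathbb R^{n_g}\to\mathbb R$ be admissible, let $\varphi:\mathbb R^{n_x}\to\mathbb R$ be continuously differentiable, and let $x_0\in\mathbb R^{n_x}$. For $g\in\mathcal G^2$ let $x(\cdot\,;g)\in (W^{1,\infty}(I))^{n_x}$ denote the solution of $$x'(t)=f\big(t,x(t),g(t,x(t))\big)\ \text{ for a.a. } t\in I,\qquad x(t_0)=x_0,$$ and put $$\widehat q(g)=\varphi\big(x(t_f;g)\big)+\int_{t_0}^{t_f} l\Big(t,x(t;g),g\big(t,x(t;g)\big)\Big)\,dt .$$ Let $g_\epsilon,g_*\in\mathcal G^2$, and suppose that this initial value problem with $g=g_\epsilon$ has a solution $x_\epsilon\in (W^{1,\infty}(I))^{n_x}$. Let $\boldsymbol\epsilon$ be an $\mathbb R^{n_g}$-valued function of $(t,x)$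 such that $t\mapsto\boldsymbol\epsilon(t,x_\epsilon(t))$ belongs to $(L^\infty(I))^{n_g}$ and, componentwise, $$|g_\epsilon(t,x_\epsilon(t))-g_*(t,x_\epsilon(t))|\le\boldsymbol\epsilon(t,x_\epsilon(t))\qquad\text{for a.a. } t\in I .$$ Write $$A_\epsilon(t)=f_x+f_g\,(g_\epsilon)_x,\qquad B_\epsilon(t)=f_g,$$ where $f_x$, $f_g$, and likewise $\nabla_x l$, $\nabla_g l$ below, are evaluated at $(t,x_\epsilon(t),g_\epsilon(t,x_\epsilon(t)))$, and $(g_\epsilon)_x$ at $(t,x_\epsilon(t))$. Then: 1. For all $g$ in a neighbourhood of $g_\epsilon$ in $\mathcal G^2$ the initial value problem has exactly one solution $x(\cdot\,;g)\in (W^{1,\infty}(I))^{n_x}$, so that $\widehat q$ is defined near $g_\epsilon$; and $\widehat q$ is Fréchet differentiable at $g_\epsilon$. 2. The adjoint equation $$-\lambda_\epsilon'(t)=A_\epsilon(t)^T\lambda_\epsilon(t)+\nabla_x l+(g_\epsilon)_x^T\,\nabla_g l\ \text{ for a.a. } t\in I,\qquad \lambda_\epsilon(t_f)=\nabla\varphi\big(x_\epsilon(t_f)\big),$$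 has exactly one solution $\lambda_\epsilon\in (W^{1,\infty}(I))^{n_x}$. It does not depend on $g_*$ or $\boldsymbol\epsilon$. 3. With this $\lambda_\epsilon$, the Fréchet derivative $\widehat q_g(g_\epsilon)$ of $\widehat q$ at $g_\epsilon$ satisfies $$\big|\widehat q_g(g_\epsilon)(g_\epsilon-g_*)\big|\le\int_{t_0}^{t_f}\big|B_\epsilon(t)^T\lambda_\epsilon(t)+\nabla_g l\big|^T\,\boldsymbol\epsilon\big(t,x_\epsilon(t)\big)\,dt ,$$ where the absolute value on the right is taken componentwise and the integrand is integrable. -/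

import Mathlib

open MeasureTheory Set Filter Topology
open scoped ENNReal

noncomputable section

/-- Lebesgue measure on the open interval `I = (t₀, t_f)`. -/
abbrev timeMeasure (t₀ tf : ℝ) : Measure ℝ := volume.restrict (Ioo t₀ tf)

section ComponentFunctions

variable {X Y : Type} [NormedAddCommGroup X] [NormedSpace ℝ X]
  [NormedAddCommGroup Y] [NormedSpace ℝ Y]

/-- The (extended) norm `∑_{n ≤ k} ess sup_{t ∈ I} sup_x ‖g⁽ⁿ⁾(t, x)‖`, where `g⁽ⁿ⁾` is the `n`-th
derivative of `g` with respect to `x`. -/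
def componentENorm (t₀ tf : ℝ) (k : ℕ) (g : ℝ → X → Y) : ℝ≥0∞ :=
  ∑ n ∈ Finset.range (k + 1),
    essSup (fun t => ⨆ x : X, ‖iteratedFDeriv ℝ n (g t) x‖ₑ) (timeMeasure t₀ tf)

/-- Membership in `𝒢ᵏ`: for a.a. `t ∈ I` the map `g(t, ·)` is `k`-times continuously
differentiable, `g(·, x)` is (Lebesgue) measurable on `I` for each `x`, and the norm is finite. -/
structure IsComponent (t₀ tf : ℝ) (k : ℕ) (g : ℝ → X → Y) : Prop where
  contDiff : ∀ᵐ t ∂(timeMeasure t₀ tf), ContDiff ℝ k (g t)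
  measurable : ∀ x : X, AEStronglyMeasurable (fun t => g t x) (timeMeasure t₀ tf)
  finite : componentENorm t₀ tf k g < ∞

theorem componentENorm_zero (t₀ tf : ℝ) (k : ℕ) :
    componentENorm t₀ tf k (0 : ℝ → X → Y) = 0 := by
  unfold componentENorm
  refine Finset.sum_eq_zero fun n _ => ?_
  have h : ∀ t : ℝ, (⨆ x : X, ‖iteratedFDeriv ℝ n ((0 : ℝ → X → Y) t) x‖ₑ) = 0 := by
    intro t
    have h0 : iteratedFDeriv ℝ n ((0 : ℝ → X → Y) t) = 0 := iteratedFDeriv_fun_zero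
    refine ENNReal.iSup_eq_zero.2 fun x => ?_
    rw [h0]
    rw [Pi.zero_apply, ← ofReal_norm, norm_zero, ENNReal.ofReal_zero]
  simp only [h]
  exact essSup_const_bot

theorem componentENorm_add_le {t₀ tf : ℝ} {k : ℕ} {g h : ℝ → X → Y}
    (hg : IsComponent t₀ tf k g) (hh : IsComponent t₀ tf k h) :
    componentENorm t₀ tf k (g + h) ≤ componentENorm t₀ tf k g + componentENorm t₀ tf k h := by
  unfold componentENorm
  rw [← Finset.sum_add_distrib]
  refine Finset.sum_le_sum fun n hn => ?_
  refine le_trans (essSup_mono_ae ?_) (ENNReal.essSup_add_le _ _)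
  filter_upwards [hg.contDiff, hh.contDiff] with t h1 h2
  refine iSup_le fun x => ?_
  have hnk : (n : WithTop ℕ∞) ≤ (k : WithTop ℕ∞) := by
    exact_mod_cast Nat.lt_succ_iff.mp (Finset.mem_range.mp hn)
  have he : iteratedFDeriv ℝ n ((g + h) t) x
      = iteratedFDeriv ℝ n (g t) x + iteratedFDeriv ℝ n (h t) x := by
    have := iteratedFDeriv_add_apply (𝕜 := ℝ) (i := n) (x := x)
      ((h1.of_le hnk).contDiffAt) ((h2.of_le hnk).contDiffAt)
    simpa using this
  rw [he]
  refine le_trans (enorm_add_le (iteratedFDeriv ℝ n (g t) x) (iteratedFDeriv ℝ n (h t) x)) ?_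
  exact add_le_add (le_iSup (fun x => ‖iteratedFDeriv ℝ n (g t) x‖ₑ) x)
    (le_iSup (fun x => ‖iteratedFDeriv ℝ n (h t) x‖ₑ) x)

theorem componentENorm_smul {t₀ tf : ℝ} {k : ℕ} {g : ℝ → X → Y} (c : ℝ)
    (hg : IsComponent t₀ tf k g) :
    componentENorm t₀ tf k (c • g) = ‖c‖ₑ * componentENorm t₀ tf k g := by
  unfold componentENorm
  rw [Finset.mul_sum]
  refine Finset.sum_congr rfl fun n hn => ?_
  rw [← ENNReal.essSup_const_mul]
  refine essSup_congr_ae ?_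
  filter_upwards [hg.contDiff] with t h1
  rw [ENNReal.mul_iSup]
  refine iSup_congr fun x => ?_
  have hnk : (n : WithTop ℕ∞) ≤ (k : WithTop ℕ∞) := by
    exact_mod_cast Nat.lt_succ_iff.mp (Finset.mem_range.mp hn)
  have he : iteratedFDeriv ℝ n ((c • g) t) x = c • iteratedFDeriv ℝ n (g t) x :=
    iteratedFDeriv_const_smul_apply (𝕜 := ℝ) (i := n) (x := x) (a := c)
      ((h1.of_le hnk).contDiffAt)
  rw [he, enorm_smul]

/-- The vector space underlying `𝒢ᵏ`. -/
def componentSubmodule (t₀ tf : ℝ) (X Y : Type) [NormedAddCommGroup X] [NormedSpace ℝ X]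
    [NormedAddCommGroup Y] [NormedSpace ℝ Y] (k : ℕ) : Submodule ℝ (ℝ → X → Y) where
  carrier := {g | IsComponent t₀ tf k g}
  zero_mem' := by
    refine ⟨Eventually.of_forall fun t => contDiff_const, fun x => ?_, ?_⟩
    · exact aestronglyMeasurable_const
    · rw [componentENorm_zero]
      exact ENNReal.zero_lt_top
  add_mem' := by
    intro g h hg hh
    refine ⟨?_, fun x => (hg.measurable x).add (hh.measurable x),
      (componentENorm_add_le hg hh).trans_lt (ENNReal.add_lt_top.2 ⟨hg.finite, hh.finite⟩)⟩
    filter_upwards [hg.contDiff, hh.contDiff] with t h1 h2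
    exact h1.add h2
  smul_mem' := by
    intro c g hg
    refine ⟨?_, fun x => (hg.measurable x).const_smul c, ?_⟩
    · filter_upwards [hg.contDiff] with t h1
      exact h1.const_smul c
    · rw [componentENorm_smul c hg]
      exact ENNReal.mul_lt_top enorm_lt_top hg.finite

/-- The space `𝒢ᵏ` of component functions `g : I × X → Y`. Its elements are functions (arbitrary
outside `I`), so its norm, installed below, is a seminorm: two functions are at distance zero
exactly if they agree for a.a. `t ∈ I` and all `x`. -/
def ComponentSpace (t₀ tf : ℝ) (X Y : Type) [NormedAddCommGroup X] [NormedSpace ℝ X]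
    [NormedAddCommGroup Y] [NormedSpace ℝ Y] (k : ℕ) : Type :=
  componentSubmodule t₀ tf X Y k

instance (t₀ tf : ℝ) (k : ℕ) : AddCommGroup (ComponentSpace t₀ tf X Y k) :=
  inferInstanceAs (AddCommGroup (componentSubmodule t₀ tf X Y k))

instance (t₀ tf : ℝ) (k : ℕ) : Module ℝ (ComponentSpace t₀ tf X Y k) :=
  inferInstanceAs (Module ℝ (componentSubmodule t₀ tf X Y k))

/-- An element of `𝒢ᵏ` as a function of `(t, x)`. -/
def ComponentSpace.toFun {t₀ tf : ℝ} {k : ℕ} (g : ComponentSpace t₀ tf X Y k) : ℝ → X → Y :=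
  Subtype.val g

instance (t₀ tf : ℝ) (k : ℕ) : CoeFun (ComponentSpace t₀ tf X Y k) (fun _ => ℝ → X → Y) :=
  ⟨ComponentSpace.toFun⟩

theorem ComponentSpace.isComponent {t₀ tf : ℝ} {k : ℕ} (g : ComponentSpace t₀ tf X Y k) :
    IsComponent t₀ tf k g := g.2

theorem ComponentSpace.add_apply {t₀ tf : ℝ} {k : ℕ} (g h : ComponentSpace t₀ tf X Y k)
    (t : ℝ) (x : X) : (g + h) t x = g t x + h t x := rfl

theorem ComponentSpace.sub_apply {t₀ tf : ℝ} {k : ℕ} (g h : ComponentSpace t₀ tf X Y k)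
    (t : ℝ) (x : X) : (g - h) t x = g t x - h t x := rfl

instance (t₀ tf : ℝ) (k : ℕ) : Norm (ComponentSpace t₀ tf X Y k) :=
  ⟨fun g => (componentENorm t₀ tf k g).toReal⟩

theorem ComponentSpace.core (t₀ tf : ℝ) (k : ℕ) :
    SeminormedSpace.Core ℝ (ComponentSpace t₀ tf X Y k) where
  norm_nonneg _ := ENNReal.toReal_nonneg
  norm_smul c g := by
    have h := componentENorm_smul c g.isComponent
    have h2 := congrArg ENNReal.toReal h
    rw [ENNReal.toReal_mul, toReal_enorm] at h2
    exact h2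
  norm_triangle g h := by
    have h1 := componentENorm_add_le g.isComponent h.isComponent
    have hne := ENNReal.add_ne_top.2 ⟨g.isComponent.finite.ne, h.isComponent.finite.ne⟩
    have h2 := ENNReal.toReal_mono hne h1
    rw [ENNReal.toReal_add g.isComponent.finite.ne h.isComponent.finite.ne] at h2
    exact h2

instance (t₀ tf : ℝ) (k : ℕ) : SeminormedAddCommGroup (ComponentSpace t₀ tf X Y k) :=
  SeminormedAddCommGroup.ofCore (ComponentSpace.core t₀ tf k)

instance (t₀ tf : ℝ) (k : ℕ) : NormedSpace ℝ (ComponentSpace t₀ tf X Y k) where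
  norm_smul_le c g := ((ComponentSpace.core t₀ tf k).norm_smul c g).le

end ComponentFunctions

section Assumptions

variable {X G Y : Type} [NormedAddCommGroup X] [NormedSpace ℝ X]
  [NormedAddCommGroup G] [NormedSpace ℝ G] [NormedAddCommGroup Y] [NormedSpace ℝ Y]

/-- The partial derivative `f_x(t, x, g)`. -/
def partialX (f : ℝ → X → G → Y) (t : ℝ) (x : X) (g : G) : X →L[ℝ] Y :=
  fderiv ℝ (fun x' => f t x' g) x

/-- The partial derivative `f_g(t, x, g)`. -/
def partialG (f : ℝ → X → G → Y) (t : ℝ) (x : X) (g : G) : G →L[ℝ] Y :=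
  fderiv ℝ (fun g' => f t x g') g

/-- Carathéodory function with linear growth in `g` at `x = 0`, locally Lipschitz in `(x, g)`
uniformly in `t`. -/
structure CaratheodoryLipschitz (t₀ tf : ℝ) (f : ℝ → X → G → Y) : Prop where
  continuous : ∀ᵐ t ∂(timeMeasure t₀ tf), Continuous fun p : X × G => f t p.1 p.2
  measurable : ∀ x g, AEStronglyMeasurable (fun t => f t x g) (timeMeasure t₀ tf)
  growth : ∃ K > (0 : ℝ), ∀ᵐ t ∂(timeMeasure t₀ tf), ∀ g, ‖f t 0 g‖ ≤ K * (‖g‖ + 1)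
  lipschitz : ∀ R > (0 : ℝ), ∃ L : ℝ, ∀ᵐ t ∂(timeMeasure t₀ tf), ∀ x₁ x₂ : X, ∀ g₁ g₂ : G,
    ‖x₁‖ ≤ R → ‖x₂‖ ≤ R → ‖g₁‖ ≤ R → ‖g₂‖ ≤ R →
      ‖f t x₁ g₁ - f t x₂ g₂‖ ≤ L * (‖x₁ - x₂‖ + ‖g₁ - g₂‖)

/-- In addition, continuously differentiable in `(x, g)`, with partial derivatives of linear growth
in `g` at `x = 0` and locally Lipschitz in `(x, g)` uniformly in `t`. -/
structure CaratheodoryC1Lipschitz (t₀ tf : ℝ) (f : ℝ → X → G → Y) : Prop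
    extends CaratheodoryLipschitz t₀ tf f where
  contDiff : ∀ᵐ t ∂(timeMeasure t₀ tf), ContDiff ℝ 1 fun p : X × G => f t p.1 p.2
  growth_deriv : ∃ K > (0 : ℝ), ∀ᵐ t ∂(timeMeasure t₀ tf), ∀ g,
    ‖partialX f t 0 g‖ ≤ K * (‖g‖ + 1) ∧ ‖partialG f t 0 g‖ ≤ K * (‖g‖ + 1)
  lipschitz_deriv : ∀ R > (0 : ℝ), ∃ L : ℝ, ∀ᵐ t ∂(timeMeasure t₀ tf),
    ∀ x₁ x₂ : X, ∀ g₁ g₂ : G, ‖x₁‖ ≤ R → ‖x₂‖ ≤ R → ‖g₁‖ ≤ R → ‖g₂‖ ≤ R →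
      ‖partialX f t x₁ g₁ - partialX f t x₂ g₂‖ + ‖partialG f t x₁ g₁ - partialG f t x₂ g₂‖
        ≤ L * (‖x₁ - x₂‖ + ‖g₁ - g₂‖)

end Assumptions

section StateAndQoI

variable {X G : Type} [NormedAddCommGroup X] [NormedSpace ℝ X]
  [NormedAddCommGroup G] [NormedSpace ℝ G]

/-- `x ∈ W^{1,∞}(I)`, through its continuous representative on `[t₀, t_f]`: `x` is absolutely
continuous with essentially bounded derivative. -/
structure MemW1Inf (t₀ tf : ℝ) (x : ℝ → X) : Prop where
  absolutelyContinuous : AbsolutelyContinuousOnInterval x t₀ tf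
  memLp_deriv : MemLp (deriv x) ∞ (timeMeasure t₀ tf)

/-- `x ∈ W^{1,∞}(I)` solves `x'(t) = f(t, x(t), g(t, x(t)))` for a.a. `t ∈ I`, `x(t₀) = x₀`. -/
structure IsState (t₀ tf : ℝ) (f : ℝ → X → G → X) (x₀ : X) (g : ℝ → X → G) (x : ℝ → X) :
    Prop where
  memW1Inf : MemW1Inf t₀ tf x
  initial : x t₀ = x₀
  ode : ∀ᵐ t ∂(timeMeasure t₀ tf), HasDerivAt x (f t (x t) (g t (x t))) t

open Classical in
/-- The solution `x(·; g)` of the initial value problem (zero if there is none). -/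
def stateSolution (t₀ tf : ℝ) (f : ℝ → X → G → X) (x₀ : X) (g : ℝ → X → G) : ℝ → X :=
  if h : ∃ x, IsState t₀ tf f x₀ g x then h.choose else 0

/-- The quantity of interest `q(x, g) = φ(x(t_f)) + ∫_I l(t, x(t), g(t, x(t))) dt`. -/
def qoi (t₀ tf : ℝ) (φ : X → ℝ) (l : ℝ → X → G → ℝ) (x : ℝ → X) (g : ℝ → X → G) : ℝ :=
  φ (x tf) + ∫ t in t₀..tf, l t (x t) (g t (x t))

/-- The reduced quantity of interest `q̂(g) = q(x(·; g), g)` on `𝒢²`. -/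
def reducedQoI (t₀ tf : ℝ) (f : ℝ → X → G → X) (x₀ : X) (φ : X → ℝ) (l : ℝ → X → G → ℝ)
    (g : ComponentSpace t₀ tf X G 2) : ℝ :=
  qoi t₀ tf φ l (stateSolution t₀ tf f x₀ g) g

end StateAndQoI

section Adjoint

variable {X G : Type} [NormedAddCommGroup X] [InnerProductSpace ℝ X] [CompleteSpace X]
  [NormedAddCommGroup G] [InnerProductSpace ℝ G] [CompleteSpace G]

/-- `A(t) = f_x + f_g g_x` along the trajectory `x`. -/
def linA (f : ℝ → X → G → X) (g : ℝ → X → G) (x : ℝ → X) (t : ℝ) : X →L[ℝ] X :=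
  partialX f t (x t) (g t (x t)) + (partialG f t (x t) (g t (x t))) ∘L (fderiv ℝ (g t) (x t))

/-- `B(t) = f_g` along the trajectory `x`. -/
def linB (f : ℝ → X → G → X) (g : ℝ → X → G) (x : ℝ → X) (t : ℝ) : G →L[ℝ] X :=
  partialG f t (x t) (g t (x t))

/-- `∇_x l(t, x(t), g(t, x(t)))`. -/
def gradXl (l : ℝ → X → G → ℝ) (g : ℝ → X → G) (x : ℝ → X) (t : ℝ) : X :=
  gradient (fun x' => l t x' (g t (x t))) (x t)

/-- `∇_g l(t, x(t), g(t, x(t)))`. -/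
def gradGl (l : ℝ → X → G → ℝ) (g : ℝ → X → G) (x : ℝ → X) (t : ℝ) : G :=
  gradient (fun g' => l t (x t) g') (g t (x t))

/-- `p ∈ W^{1,∞}(I)` solves the adjoint equation
`-p' = Aᵀ p + ∇_x l + g_xᵀ ∇_g l` for a.a. `t ∈ I`, `p(t_f) = ∇φ(x(t_f))`. -/
structure IsAdjoint (t₀ tf : ℝ) (f : ℝ → X → G → X) (φ : X → ℝ) (l : ℝ → X → G → ℝ)
    (g : ℝ → X → G) (x p : ℝ → X) : Prop where
  memW1Inf : MemW1Inf t₀ tf p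
  terminal : p tf = gradient φ (x tf)
  ode : ∀ᵐ t ∂(timeMeasure t₀ tf), HasDerivAt p
    (-((linA f g x t).adjoint (p t) + gradXl l g x t
      + (fderiv ℝ (g t) (x t)).adjoint (gradGl l g x t))) t

end Adjoint

end

/-! The derivative is found directly from the adjoint, without a linearised state equation. Let `x`
be the state for a nearby `g`, let `δ = g - gε`, and let `p` solve the adjoint equation. Integrating
the derivative of `⟨p, x - xε⟩` over the time interval leaves only the end value `φ'(xε(tf))(x(tf) -
xε(tf))`, because both states start at `x₀`. Adding this identity to the difference of the
quantities of interest, the adjoint equation cancels every term of first order in `x - xε`. What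
remains is `∫ ⟨Bᵀp + ∇_g l, δ(t, xε)⟩`, a remainder quadratic in `‖x - xε‖ + ‖δ‖`, and the Taylor
remainder of `φ`. Since `‖x - xε‖ ≤ C‖δ‖`, both remainders are `o(‖δ‖)`, so the integral is the
Fréchet derivative at `δ`. The error bound is then a componentwise estimate of the integrand.

Three facts carry this. `exists_feedback_estimates` gives bounds and quadratic Taylor remainders for
`h(t, x, g(t, x))`, uniform on bounded sets; second-order control of `g` enters there.
`IsState.exists_near` gives solvability near `gε` and the Lipschitz dependence on `g`: the field is
truncated, solved globally by Picard iteration, and Grönwall shows that the truncation is never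
active. `IsBoundedPrimitive` turns `W^{1,∞}` solutions into integral equations, on which Picard,
Grönwall and the product rule operate. -/

noncomputable section

/-! ### Measurability of Carathéodory compositions and derivatives -/

section Measurability

variable {α Z Y : Type*} [MeasurableSpace α] {μ : Measure α}

/-- Composition of a Carathéodory function with a simple function. -/
theorem MeasureTheory.SimpleFunc.aestronglyMeasurable_caratheodory_comp
    [Nonempty Z] [TopologicalSpace Y] [TopologicalSpace.PseudoMetrizableSpace Y] {F : α → Z → Y}
    (hm : ∀ z, AEStronglyMeasurable (fun t => F t z) μ) (s : SimpleFunc α Z) :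
    AEStronglyMeasurable (fun t => F t (s t)) μ := by
  classical
  induction s using SimpleFunc.induction' with
  | const z => exact hm z
  | @pcw f g s hs hf hg =>
    refine (AEStronglyMeasurable.piecewise hs hf.restrict hg.restrict).congr
      (Eventually.of_forall fun t => ?_)
    by_cases ht : t ∈ s <;> simp [ht]

/-- Composition of a Carathéodory function with a measurable function. -/
theorem MeasureTheory.AEStronglyMeasurable.caratheodory_comp [TopologicalSpace Z]
    [Nonempty Z] [TopologicalSpace Y] [TopologicalSpace.PseudoMetrizableSpace Y] {F : α → Z → Y}
    (hc : ∀ᵐ t ∂μ, Continuous (F t)) (hm : ∀ z, AEStronglyMeasurable (fun t => F t z) μ)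
    {u : α → Z} (hu : AEStronglyMeasurable u μ) :
    AEStronglyMeasurable (fun t => F t (u t)) μ := by
  obtain ⟨u', hu', huu'⟩ := hu
  suffices h : AEStronglyMeasurable (fun t => F t (u' t)) μ by
    refine h.congr ?_
    filter_upwards [huu'] with t ht
    rw [ht]
  refine aestronglyMeasurable_of_tendsto_ae atTop
    (f := fun n t => F t (hu'.approx n t))
    (fun n => SimpleFunc.aestronglyMeasurable_caratheodory_comp hm _) ?_
  filter_upwards [hc] with t ht
  exact (ht.tendsto _).comp (hu'.tendsto_approx t)

/-- The directional derivative of a differentiable Carathéodory function along measurable data is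
measurable. -/
theorem MeasureTheory.AEStronglyMeasurable.caratheodory_fderiv
    [NormedAddCommGroup Z] [NormedSpace ℝ Z] [NormedAddCommGroup Y] [NormedSpace ℝ Y]
    {F : α → Z → Y} (hd : ∀ᵐ t ∂μ, Differentiable ℝ (F t))
    (hm : ∀ z, AEStronglyMeasurable (fun t => F t z) μ)
    {u w : α → Z} (hu : AEStronglyMeasurable u μ) (hw : AEStronglyMeasurable w μ) :
    AEStronglyMeasurable (fun t => fderiv ℝ (F t) (u t) (w t)) μ := by
  have hc : ∀ᵐ t ∂μ, Continuous (F t) := hd.mono fun t ht => ht.continuous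
  -- The derivative is the a.e. limit of difference quotients with step `1/n`, each measurable as a
  -- composition; the junk term at `n = 0` is harmless.
  refine aestronglyMeasurable_of_tendsto_ae atTop
    (f := fun (n : ℕ) t => (n : ℝ) • (F t (u t + (n : ℝ)⁻¹ • w t) - F t (u t))) (fun n => ?_) ?_
  · exact ((AEStronglyMeasurable.caratheodory_comp hc hm (hu.add (hw.const_smul _))).sub
      (AEStronglyMeasurable.caratheodory_comp hc hm hu)).const_smul _
  · filter_upwards [hd] with t ht
    have h := (ht (u t)).hasFDerivAt.lim (w t) (c := fun n : ℕ => (n : ℝ)) (l := atTop)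
      (by simpa using tendsto_natCast_atTop_atTop)
    exact h

/-- Expansion in an orthonormal basis. It lets adjoint operators be treated through their pairings
with fixed vectors, without measurability of operator-valued maps. -/
theorem aestronglyMeasurable_of_inner [NormedAddCommGroup Z] [InnerProductSpace ℝ Z]
    [FiniteDimensional ℝ Z] {v : α → Z}
    (h : ∀ e : Z, AEStronglyMeasurable (fun t => inner ℝ e (v t)) μ) :
    AEStronglyMeasurable v μ := by
  have hv : v = fun t => ∑ i, inner ℝ (stdOrthonormalBasis ℝ Z i) (v t) •
      stdOrthonormalBasis ℝ Z i := by
    funext t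
    exact ((stdOrthonormalBasis ℝ Z).sum_repr' (v t)).symm
  rw [hv]
  exact Finset.aestronglyMeasurable_fun_sum _ fun i _ => (h _).smul_const _

end Measurability

/-! ### Integral estimates and Grönwall's inequality -/

section IntervalTools

variable {a b : ℝ} {X : Type*} [NormedAddCommGroup X]

theorem ae_timeMeasure_iff {p : ℝ → Prop} :
    (∀ᵐ t ∂(timeMeasure a b), p t) ↔ ∀ᵐ t, t ∈ Ioc a b → p t := by
  rw [timeMeasure, Measure.restrict_congr_set Ioo_ae_eq_Ioc, ae_restrict_iff' measurableSet_Ioc]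

theorem ContinuousOn.aestronglyMeasurable_timeMeasure {x : ℝ → X}
    (hx : ContinuousOn x (Icc a b)) : AEStronglyMeasurable x (timeMeasure a b) :=
  (hx.mono Ioo_subset_Icc_self).aestronglyMeasurable measurableSet_Ioo

theorem intervalIntegrable_of_ae_bound (hab : a ≤ b) {v : ℝ → X} {M : ℝ}
    (hv : AEStronglyMeasurable v (timeMeasure a b)) (hM : ∀ᵐ t ∂(timeMeasure a b), ‖v t‖ ≤ M) :
    IntervalIntegrable v volume a b := by
  rw [intervalIntegrable_iff_integrableOn_Ioo_of_le hab]
  exact Integrable.of_bound hv M hM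

variable [NormedSpace ℝ X]

theorem norm_integral_le_of_ae_bound {v : ℝ → X} {M : ℝ} (hM : ∀ᵐ t ∂(timeMeasure a b), ‖v t‖ ≤ M)
    {s t : ℝ} (hs : s ∈ Icc a b) (ht : t ∈ Icc a b) :
    ‖∫ r in s..t, v r‖ ≤ M * |t - s| := by
  refine intervalIntegral.norm_integral_le_of_norm_le_const_ae ?_
  filter_upwards [ae_timeMeasure_iff.1 hM] with r hr hrs
  refine hr ⟨lt_of_le_of_lt (le_min hs.1 ht.1) hrs.1, hrs.2.trans (max_le hs.2 ht.2)⟩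

/-- An integral form of Grönwall's inequality. -/
theorem le_mul_gronwallBound_of_le_integral {w : ℝ → ℝ} {K c : ℝ} (hK : 0 ≤ K) (hc : 0 ≤ c)
    (hw : ContinuousOn w (Icc a b)) (hw0 : ∀ t ∈ Icc a b, 0 ≤ w t)
    (h : ∀ t ∈ Icc a b, w t ≤ ∫ s in a..t, (K * w s + c)) :
    ∀ t ∈ Icc a b, w t ≤ c * gronwallBound 0 K 1 (b - a) := by
  intro t ht
  have hab : a ≤ b := ht.1.trans ht.2
  have hcont : ContinuousOn (fun s => K * w s + c) (Icc a b) :=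
    (continuousOn_const.mul hw).add continuousOn_const
  have hint : IntervalIntegrable (fun s => K * w s + c) volume a b := by
    apply ContinuousOn.intervalIntegrable
    rwa [uIcc_of_le hab]
  -- `w` need not be differentiable, so the differential Grönwall inequality is applied to its
  -- majorant `E`, whose right derivative is `K w + c ≤ K E + c`.
  set E : ℝ → ℝ := fun t => ∫ s in a..t, (K * w s + c) with hE
  have hE0 : ∀ t ∈ Icc a b, 0 ≤ E t := fun t ht => (hw0 t ht).trans (h t ht)
  have hEc : ContinuousOn E (Icc a b) := by
    have := intervalIntegral.continuousOn_primitive_interval' hint left_mem_uIcc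
    rwa [uIcc_of_le hab] at this
  have hg := norm_le_gronwallBound_of_norm_deriv_right_le (f := E) (f' := fun s => K * w s + c)
    (δ := 0) (K := K) (ε := c) (a := a) (b := b) hEc (fun s hs => ?_) (by simp [hE])
    (fun s hs => ?_) t ht
  · have hmono := gronwallBound_mono (le_refl 0) hc hK (sub_le_sub_right ht.2 a)
    -- With zero initial value the bound is linear in `c`; this later yields Lipschitz dependence on
    -- `g`.
    have hlin : gronwallBound 0 K c (b - a) = c * gronwallBound 0 K 1 (b - a) := by
      unfold gronwallBound
      split_ifs <;> ring
    rw [Real.norm_of_nonneg (hE0 t ht)] at hg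
    linarith [h t ht]
  · have hs' : s ∈ Icc a b := Ico_subset_Icc_self hs
    have hi : IntervalIntegrable (fun s => K * w s + c) volume a s :=
      hint.mono_set (by rw [uIcc_of_le hs.1, uIcc_of_le hab]; exact Icc_subset_Icc_right hs.2.le)
    have hcs : ContinuousWithinAt (fun s => K * w s + c) (Ici s) s := by
      refine (hcont s hs').mono_of_mem_nhdsWithin ?_
      exact mem_of_superset (Icc_mem_nhdsGE hs.2) (Icc_subset_Icc_left hs.1)
    refine intervalIntegral.integral_hasDerivWithinAt_right hi ?_ (hcs.mono Ioi_subset_Ici_self)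
    refine ⟨Ioc s b, Ioc_mem_nhdsGT hs.2, ?_⟩
    exact (hcont.mono (Ioc_subset_Icc_self.trans (Icc_subset_Icc_left hs.1))).aestronglyMeasurable
      measurableSet_Ioc
  · have hs' : s ∈ Icc a b := Ico_subset_Icc_self hs
    rw [Real.norm_of_nonneg (by have := hw0 s hs'; positivity), Real.norm_of_nonneg (hE0 s hs')]
    have := mul_le_mul_of_nonneg_left (h s hs') hK
    linarith

end IntervalTools

/-! ### Primitives of bounded functions as a form of `W^{1,∞}` -/

section Primitive

variable {a b : ℝ} {X : Type} [NormedAddCommGroup X] [NormedSpace ℝ X]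

/-- On `[a, b]`, the function `x` is a primitive of the bounded measurable function `v`. -/
structure IsBoundedPrimitive (a b : ℝ) (x v : ℝ → X) : Prop where
  aestronglyMeasurable : AEStronglyMeasurable v (timeMeasure a b)
  bound : ∃ M, ∀ᵐ t ∂(timeMeasure a b), ‖v t‖ ≤ M
  eq_integral : ∀ t ∈ Icc a b, x t = x a + ∫ s in a..t, v s

namespace IsBoundedPrimitive

variable {x y v w : ℝ → X}

theorem bound_nonneg (h : IsBoundedPrimitive a b x v) :
    ∃ M, 0 ≤ M ∧ ∀ᵐ t ∂(timeMeasure a b), ‖v t‖ ≤ M := by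
  obtain ⟨M, hM⟩ := h.bound
  exact ⟨max M 0, le_max_right _ _, hM.mono fun t ht => ht.trans (le_max_left _ _)⟩

theorem intervalIntegrable (h : IsBoundedPrimitive a b x v) {s t : ℝ}
    (hs : s ∈ Icc a b) (ht : t ∈ Icc a b) : IntervalIntegrable v volume s t := by
  obtain ⟨M, hM⟩ := h.bound
  have hab : a ≤ b := hs.1.trans hs.2
  refine (intervalIntegrable_of_ae_bound hab h.aestronglyMeasurable hM).mono_set ?_
  rw [uIcc_of_le hab]
  exact uIcc_subset_Icc hs ht

theorem sub_eq_integral (h : IsBoundedPrimitive a b x v) {s t : ℝ}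
    (hs : s ∈ Icc a b) (ht : t ∈ Icc a b) : x t - x s = ∫ r in s..t, v r := by
  have ha : a ∈ Icc a b := ⟨le_rfl, hs.1.trans hs.2⟩
  rw [h.eq_integral t ht, h.eq_integral s hs, add_sub_add_left_eq_sub,
    intervalIntegral.integral_interval_sub_left (h.intervalIntegrable ha ht)
      (h.intervalIntegrable ha hs)]

theorem exists_lipschitz (h : IsBoundedPrimitive a b x v) :
    ∃ M : ℝ, 0 ≤ M ∧ ∀ s ∈ Icc a b, ∀ t ∈ Icc a b, ‖x t - x s‖ ≤ M * |t - s| := by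
  obtain ⟨M, hM0, hM⟩ := h.bound_nonneg
  refine ⟨M, hM0, fun s hs t ht => ?_⟩
  rw [h.sub_eq_integral hs ht]
  exact norm_integral_le_of_ae_bound hM hs ht

omit [NormedSpace ℝ X] in
theorem absolutelyContinuousOnInterval (hab : a ≤ b) {x : ℝ → X}
    (h : ∃ M : ℝ, 0 ≤ M ∧ ∀ s ∈ Icc a b, ∀ t ∈ Icc a b, ‖x t - x s‖ ≤ M * |t - s|) :
    AbsolutelyContinuousOnInterval x a b := by
  obtain ⟨M, hM0, hM⟩ := h
  refine LipschitzOnWith.absolutelyContinuousOnInterval (K := ⟨M, hM0⟩) ?_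
  rw [uIcc_of_le hab]
  refine LipschitzOnWith.of_dist_le_mul fun s hs t ht => ?_
  rw [dist_eq_norm, Real.dist_eq]
  exact hM t ht s hs

theorem ae_hasDerivAt [CompleteSpace X] (hab : a ≤ b) (h : IsBoundedPrimitive a b x v) :
    ∀ᵐ t ∂(timeMeasure a b), HasDerivAt x (v t) t := by
  have h1 := (h.intervalIntegrable (left_mem_Icc.2 hab) (right_mem_Icc.2 hab)).ae_hasDerivAt_integral
  filter_upwards [ae_restrict_of_ae h1, ae_restrict_mem measurableSet_Ioo] with t ht hmem
  have h2 := ht (by rw [uIcc_of_le hab]; exact Ioo_subset_Icc_self hmem) a left_mem_uIcc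
  refine (h2.const_add (x a)).congr_of_eventuallyEq ?_
  filter_upwards [Ioo_mem_nhds hmem.1 hmem.2] with s hs
  exact h.eq_integral s (Ioo_subset_Icc_self hs)

theorem memW1Inf [CompleteSpace X] (hab : a ≤ b) (h : IsBoundedPrimitive a b x v) :
    MemW1Inf a b x := by
  refine ⟨absolutelyContinuousOnInterval hab h.exists_lipschitz, ?_⟩
  obtain ⟨M, hM⟩ := h.bound
  refine MemLp.ae_eq ?_ (memLp_top_of_bound h.aestronglyMeasurable M hM)
  filter_upwards [h.ae_hasDerivAt hab] with t ht
  exact ht.deriv.symm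

/-- `x - ∫ v` is absolutely continuous with zero derivative a.e., hence constant. Boundedness of `v`
makes the integral Lipschitz, so that it is absolutely continuous too. -/
theorem of_ae_hasDerivAt [CompleteSpace X] (hab : a ≤ b) (hx : AbsolutelyContinuousOnInterval x a b)
    (hd : ∀ᵐ t ∂(timeMeasure a b), HasDerivAt x (v t) t)
    (hv : AEStronglyMeasurable v (timeMeasure a b))
    (hM : ∃ M, ∀ᵐ t ∂(timeMeasure a b), ‖v t‖ ≤ M) : IsBoundedPrimitive a b x v := by
  have h0 : IsBoundedPrimitive a b (fun t => ∫ s in a..t, v s) v :=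
    ⟨hv, hM, fun t _ => by simp⟩
  refine ⟨hv, hM, ?_⟩
  have hac := hx.sub (absolutelyContinuousOnInterval hab h0.exists_lipschitz)
  obtain ⟨C, hC⟩ := hac.const_of_ae_hasDerivAt_zero (by
    rw [uIcc_of_le hab]
    have h1 : ∀ᵐ t ∂(volume.restrict (Icc a b)),
        HasDerivAt x (v t) t ∧ HasDerivAt (fun t => ∫ s in a..t, v s) (v t) t := by
      rw [← Measure.restrict_congr_set Ioo_ae_eq_Icc]
      exact hd.and (h0.ae_hasDerivAt hab)
    filter_upwards [(ae_restrict_iff' measurableSet_Icc).1 h1] with t ht hmem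
    simpa using! (ht hmem).1.sub (ht hmem).2)
  intro t ht
  rw [uIcc_of_le hab] at hC
  have e1 := hC t ht
  have e2 := hC a (left_mem_Icc.2 hab)
  simp only [Pi.sub_apply, intervalIntegral.integral_same, sub_zero] at e1 e2
  rw [e2, ← e1]
  abel

/-- `v` inherits measurability and essential boundedness from `deriv x`, so nothing has to be known
about the right-hand side of the differential equation. -/
theorem of_memW1Inf [CompleteSpace X] (hab : a ≤ b) (hx : MemW1Inf a b x)
    (hd : ∀ᵐ t ∂(timeMeasure a b), HasDerivAt x (v t) t) : IsBoundedPrimitive a b x v := by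
  have he : deriv x =ᵐ[timeMeasure a b] v := hd.mono fun t ht => ht.deriv
  have hv : MemLp v ∞ (timeMeasure a b) := hx.memLp_deriv.ae_eq he
  refine of_ae_hasDerivAt hab hx.absolutelyContinuous hd hv.1 ?_
  have h2 := ae_le_eLpNormEssSup (f := v) (μ := timeMeasure a b)
  refine ⟨(eLpNormEssSup v (timeMeasure a b)).toReal, ?_⟩
  have hlt : eLpNormEssSup v (timeMeasure a b) < ∞ := by simpa using hv.2
  filter_upwards [h2] with t ht
  rw [← toReal_enorm]
  exact ENNReal.toReal_mono hlt.ne ht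

theorem congr (h : IsBoundedPrimitive a b x v) (hy : EqOn y x (Icc a b))
    (hw : w =ᵐ[timeMeasure a b] v) : IsBoundedPrimitive a b y w := by
  refine ⟨h.aestronglyMeasurable.congr hw.symm, ?_, fun t ht => ?_⟩
  · obtain ⟨M, hM⟩ := h.bound
    refine ⟨M, ?_⟩
    filter_upwards [hM, hw] with t h1 h2
    rwa [h2]
  · rw [hy ht, hy ⟨le_rfl, ht.1.trans ht.2⟩, h.eq_integral t ht]
    congr 1
    refine intervalIntegral.integral_congr_ae ?_
    filter_upwards [ae_timeMeasure_iff.1 hw] with r hr hrs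
    rw [uIoc_of_le ht.1] at hrs
    exact (hr ⟨hrs.1, hrs.2.trans ht.2⟩).symm

theorem continuousOn (h : IsBoundedPrimitive a b x v) : ContinuousOn x (Icc a b) := by
  obtain ⟨M, hM0, hM⟩ := h.exists_lipschitz
  have : LipschitzOnWith ⟨M, hM0⟩ x (Icc a b) := by
    refine LipschitzOnWith.of_dist_le_mul fun s hs t ht => ?_
    rw [dist_eq_norm, Real.dist_eq]
    exact hM t ht s hs
  exact this.continuousOn

theorem exists_norm_le (h : IsBoundedPrimitive a b x v) :
    ∃ R, 0 < R ∧ ∀ t ∈ Icc a b, ‖x t‖ ≤ R := by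
  obtain ⟨R, hR⟩ := isCompact_Icc.exists_bound_of_continuousOn h.continuousOn
  exact ⟨max R 1, by positivity, fun t ht => (hR t ht).trans (le_max_left _ _)⟩

theorem sub (hx : IsBoundedPrimitive a b x v) (hy : IsBoundedPrimitive a b y w) :
    IsBoundedPrimitive a b (fun t => x t - y t) (fun t => v t - w t) := by
  obtain ⟨M, hM⟩ := hx.bound
  obtain ⟨N, hN⟩ := hy.bound
  refine ⟨hx.aestronglyMeasurable.sub hy.aestronglyMeasurable, ⟨M + N, ?_⟩, fun t ht => ?_⟩
  · filter_upwards [hM, hN] with t h1 h2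
    exact (norm_sub_le _ _).trans (add_le_add h1 h2)
  · have ha : a ∈ Icc a b := ⟨le_rfl, ht.1.trans ht.2⟩
    rw [intervalIntegral.integral_sub (hx.intervalIntegrable ha ht) (hy.intervalIntegrable ha ht),
      hx.eq_integral t ht, hy.eq_integral t ht]
    abel

/-- The map `t ↦ a + b - t` preserves Lebesgue measure and the interval. Reflection reduces terminal
value problems to initial value problems. -/
theorem ae_reflect {p : ℝ → Prop} (h : ∀ᵐ t ∂(timeMeasure a b), p t) :
    ∀ᵐ t ∂(timeMeasure a b), p (a + b - t) := by
  have hm : MeasurePreserving (fun t : ℝ => a + b - t) volume volume :=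
    Measure.measurePreserving_sub_left volume (a + b)
  have h1 := (ae_restrict_iff' measurableSet_Ioo).1 h
  refine (ae_restrict_iff' measurableSet_Ioo).2 ?_
  filter_upwards [hm.quasiMeasurePreserving.ae h1] with t ht hmem
  exact ht ⟨by linarith [hmem.2], by linarith [hmem.1]⟩

theorem _root_.MeasureTheory.AEStronglyMeasurable.reflect {Y : Type*} [TopologicalSpace Y]
    {u : ℝ → Y} (h : AEStronglyMeasurable u (timeMeasure a b)) :
    AEStronglyMeasurable (fun t => u (a + b - t)) (timeMeasure a b) := by
  refine h.comp_quasiMeasurePreserving (f := fun t : ℝ => a + b - t) ?_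
  have hm : Measurable (fun t : ℝ => a + b - t) := by fun_prop
  refine ⟨hm, ?_⟩
  refine Measure.AbsolutelyContinuous.mk fun s hs h0 => ?_
  rw [Measure.map_apply hm hs]
  have h1 : ∀ᵐ t ∂(timeMeasure a b), t ∉ s := by
    rw [ae_iff]
    simpa using! h0
  have h2 := ae_reflect h1
  rw [ae_iff] at h2
  simpa using! h2

theorem reflect (hab : a ≤ b) (h : IsBoundedPrimitive a b x v) :
    IsBoundedPrimitive a b (fun t => x (a + b - t)) (fun t => -v (a + b - t)) := by
  obtain ⟨M, hM⟩ := h.bound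
  refine ⟨h.aestronglyMeasurable.reflect.neg, ⟨M, ?_⟩, fun t ht => ?_⟩
  · filter_upwards [ae_reflect hM] with t ht
    rwa [norm_neg]
  · have ht' : a + b - t ∈ Icc a b := ⟨by linarith [ht.2], by linarith [ht.1]⟩
    have h1 := h.sub_eq_integral (right_mem_Icc.2 hab) ht'
    rw [intervalIntegral.integral_neg,
      intervalIntegral.integral_comp_sub_left (fun s => v s) (a + b),
      ← intervalIntegral.integral_symm]
    simp only [add_sub_cancel_left]
    rw [← h1]
    abel

/-- Grönwall's inequality: two primitives with close derivatives and the same initial value are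
close. -/
theorem norm_sub_le (hx : IsBoundedPrimitive a b x v) (hy : IsBoundedPrimitive a b y w)
    (h0 : x a = y a) {K c : ℝ} (hK : 0 ≤ K) (hc : 0 ≤ c)
    (h : ∀ᵐ t ∂(timeMeasure a b), ‖v t - w t‖ ≤ K * ‖x t - y t‖ + c) :
    ∀ t ∈ Icc a b, ‖x t - y t‖ ≤ c * gronwallBound 0 K 1 (b - a) := by
  have hd := hx.sub hy
  refine le_mul_gronwallBound_of_le_integral hK hc hd.continuousOn.norm
    (fun _ _ => norm_nonneg _) fun t ht => ?_
  have ha : a ∈ Icc a b := ⟨le_rfl, ht.1.trans ht.2⟩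
  have e := hd.eq_integral t ht
  rw [h0, sub_self, zero_add] at e
  rw [e]
  refine intervalIntegral.norm_integral_le_of_norm_le ht.1 ?_ ?_
  · filter_upwards [ae_timeMeasure_iff.1 h] with r hr hrs
    exact hr ⟨hrs.1, hrs.2.trans ht.2⟩
  · apply ContinuousOn.intervalIntegrable
    rw [uIcc_of_le ht.1]
    exact ((continuousOn_const.mul hd.continuousOn.norm).add continuousOn_const).mono
      (Icc_subset_Icc_right ht.2)

theorem norm_sub_le_of_right (hab : a ≤ b) (hx : IsBoundedPrimitive a b x v)
    (hy : IsBoundedPrimitive a b y w)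
    (h0 : x b = y b) {K c : ℝ} (hK : 0 ≤ K) (hc : 0 ≤ c)
    (h : ∀ᵐ t ∂(timeMeasure a b), ‖v t - w t‖ ≤ K * ‖x t - y t‖ + c) :
    ∀ t ∈ Icc a b, ‖x t - y t‖ ≤ c * gronwallBound 0 K 1 (b - a) := by
  intro t ht
  have := (hx.reflect hab).norm_sub_le (hy.reflect hab) (by simpa using h0) hK hc (by
    filter_upwards [ae_reflect h] with t ht
    rwa [neg_sub_neg, norm_sub_rev]) (a + b - t) ⟨by linarith [ht.2], by linarith [ht.1]⟩
  simpa using this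

end IsBoundedPrimitive

end Primitive

/-! ### Global Picard iteration for Lipschitz fields -/

section Existence

open scoped Nat

variable {a b : ℝ} {X : Type} [NormedAddCommGroup X] [NormedSpace ℝ X]

/-- A right-hand side that is measurable in time, uniformly Lipschitz in space and bounded
at the origin. -/
structure IsLipschitzField (a b L M : ℝ) (F : ℝ → X → X) : Prop where
  measurable : ∀ x, AEStronglyMeasurable (fun t => F t x) (timeMeasure a b)
  nonneg : 0 ≤ L
  lipschitz : ∀ᵐ t ∂(timeMeasure a b), ∀ x y, ‖F t x - F t y‖ ≤ L * ‖x - y‖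
  bound : ∀ᵐ t ∂(timeMeasure a b), ‖F t 0‖ ≤ M

namespace IsLipschitzField

variable {L M : ℝ} {F : ℝ → X → X}

omit [NormedSpace ℝ X] in
theorem aestronglyMeasurable_comp (h : IsLipschitzField a b L M F) {u : ℝ → X}
    (hu : AEStronglyMeasurable u (timeMeasure a b)) :
    AEStronglyMeasurable (fun t => F t (u t)) (timeMeasure a b) := by
  refine AEStronglyMeasurable.caratheodory_comp ?_ h.measurable hu
  filter_upwards [h.lipschitz] with t ht
  refine (LipschitzWith.of_dist_le_mul (K := ⟨L, h.nonneg⟩) fun x y => ?_).continuous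
  rw [dist_eq_norm, dist_eq_norm]
  exact ht x y

theorem isBoundedPrimitive_integral (h : IsLipschitzField a b L M F) (x₀ : X) {u : ℝ → X}
    (hu : ContinuousOn u (Icc a b)) :
    IsBoundedPrimitive a b (fun t => x₀ + ∫ s in a..t, F s (u s)) (fun t => F t (u t)) := by
  refine ⟨h.aestronglyMeasurable_comp hu.aestronglyMeasurable_timeMeasure, ?_,
    fun t _ => by simp⟩
  obtain ⟨R, hR⟩ := isCompact_Icc.exists_bound_of_continuousOn hu
  refine ⟨L * R + M, ?_⟩
  filter_upwards [h.lipschitz, h.bound, ae_restrict_mem measurableSet_Ioo] with t h1 h2 h3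
  have h4 := h1 (u t) 0
  have h5 := norm_sub_norm_le (F t (u t)) (F t 0)
  have h6 := mul_le_mul_of_nonneg_left (hR t (Ioo_subset_Icc_self h3)) h.nonneg
  rw [sub_zero] at h4
  linarith

/-- The Picard operator of a Lipschitz field. -/
def picardMap (h : IsLipschitzField a b L M F) (hab : a ≤ b) (x₀ : X) (u : C(Icc a b, X)) :
    C(Icc a b, X) where
  toFun t := x₀ + ∫ s in a..t, F s (IccExtend hab u s)
  continuous_toFun := (h.isBoundedPrimitive_integral x₀
    (u.continuous.Icc_extend' (h := hab)).continuousOn).continuousOn.domRestrict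

/-- Each integration of the previous bound gains a factor `L (t - a) / (n + 1)`. The factorial makes
some iterate a contraction on the whole interval, however large `L (b - a)` is. -/
theorem norm_iterate_picardMap_sub_le (h : IsLipschitzField a b L M F) (hab : a ≤ b) (x₀ : X)
    (u v : C(Icc a b, X)) (n : ℕ) (t : Icc a b) :
    ‖(h.picardMap hab x₀)^[n] u t - (h.picardMap hab x₀)^[n] v t‖ ≤
      (L * (t - a)) ^ n / n ! * ‖u - v‖ := by
  induction n generalizing t with
  | zero => simpa using (u - v).norm_coe_le_norm t
  | succ n ih =>
    rw [Function.iterate_succ_apply', Function.iterate_succ_apply']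
    set U := (h.picardMap hab x₀)^[n] u
    set V := (h.picardMap hab x₀)^[n] v
    have hU := (h.isBoundedPrimitive_integral x₀
      (U.continuous.Icc_extend' (h := hab)).continuousOn)
    have hV := (h.isBoundedPrimitive_integral x₀
      (V.continuous.Icc_extend' (h := hab)).continuousOn)
    have e := (hU.sub hV).eq_integral t t.2
    simp only [intervalIntegral.integral_same, sub_self, zero_add] at e
    change ‖(x₀ + ∫ s in a..t, F s (IccExtend hab U s)) -
      (x₀ + ∫ s in a..t, F s (IccExtend hab V s))‖ ≤ _
    rw [e]
    have hn : (n ! : ℝ) ≠ 0 := by positivity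
    have hi : ∫ s in a..(t : ℝ), L * ((L * (s - a)) ^ n / n ! * ‖u - v‖) =
        (L * (t - a)) ^ (n + 1) / (n + 1)! * ‖u - v‖ := by
      have : ∀ s : ℝ, L * ((L * (s - a)) ^ n / n ! * ‖u - v‖) =
          (L ^ (n + 1) / n ! * ‖u - v‖) * (s - a) ^ n := fun s => by
        rw [mul_pow, pow_succ]; ring
      simp only [this]
      rw [intervalIntegral.integral_const_mul,
        intervalIntegral.integral_comp_sub_right (fun s => s ^ n) a, integral_pow,
        Nat.factorial_succ]
      push_cast
      rw [mul_pow, sub_self, zero_pow (by omega)]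
      field_simp
      ring
    rw [← hi]
    refine intervalIntegral.norm_integral_le_of_norm_le t.2.1 ?_
      (Continuous.intervalIntegrable (by fun_prop) _ _)
    filter_upwards [ae_timeMeasure_iff.1 h.lipschitz] with r hr hrs
    have hr' : r ∈ Icc a b := ⟨hrs.1.le, hrs.2.trans t.2.2⟩
    refine (hr ⟨hrs.1, hr'.2⟩ _ _).trans (mul_le_mul_of_nonneg_left ?_ h.nonneg)
    rw [IccExtend_of_mem _ _ hr', IccExtend_of_mem _ _ hr']
    exact ih ⟨r, hr'⟩

/-- Global existence for Lipschitz fields. -/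
theorem exists_isBoundedPrimitive [CompleteSpace X] (h : IsLipschitzField a b L M F) (hab : a ≤ b)
    (x₀ : X) : ∃ x, x a = x₀ ∧ IsBoundedPrimitive a b x (fun t => F t (x t)) := by
  obtain ⟨n, hn⟩ := (FloorSemiring.tendsto_pow_div_factorial_atTop (L * (b - a))).eventually
    (gt_mem_nhds zero_lt_one) |>.exists
  have hLab : 0 ≤ L * (b - a) := mul_nonneg h.nonneg (sub_nonneg.2 hab)
  have hn0 : 0 ≤ (L * (b - a)) ^ n / n ! := by positivity
  have hc : ContractingWith ⟨_, hn0⟩ (h.picardMap hab x₀)^[n] := by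
    refine ⟨hn, LipschitzWith.of_dist_le_mul fun u v => ?_⟩
    rw [dist_eq_norm, dist_eq_norm]
    refine (ContinuousMap.norm_le _ (by positivity)).2 fun t => ?_
    refine (h.norm_iterate_picardMap_sub_le hab x₀ u v n t).trans ?_
    have h1 : 0 ≤ (t : ℝ) - a := sub_nonneg.2 t.2.1
    have h2 : (t : ℝ) - a ≤ b - a := sub_le_sub_right t.2.2 a
    have h3 := h.nonneg
    change _ ≤ (L * (b - a)) ^ n / n ! * ‖u - v‖
    gcongr
  -- The fixed point of the contracting iterate is a fixed point of the Picard map itself.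
  have hfix := hc.isFixedPt_fixedPoint_iterate
  set u := hc.fixedPoint _
  have hu : ∀ t ∈ Icc a b, IccExtend hab u t = x₀ + ∫ s in a..t, F s (IccExtend hab u s) := by
    intro t ht
    rw [IccExtend_of_mem _ _ ht]
    exact (DFunLike.congr_fun hfix ⟨t, ht⟩).symm
  refine ⟨IccExtend hab u, ?_, ?_⟩
  · simpa using hu a (left_mem_Icc.2 hab)
  · exact (h.isBoundedPrimitive_integral x₀
      (u.continuous.Icc_extend' (h := hab)).continuousOn).congr hu EventuallyEq.rfl

omit [NormedSpace ℝ X] in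
theorem reflect (h : IsLipschitzField a b L M F) :
    IsLipschitzField a b L M (fun t x => -F (a + b - t) x) := by
  refine ⟨fun x => (h.measurable x).reflect.neg, h.nonneg, ?_, ?_⟩
  · filter_upwards [IsBoundedPrimitive.ae_reflect h.lipschitz] with t ht x y
    rw [neg_sub_neg, norm_sub_rev]
    exact ht x y
  · filter_upwards [IsBoundedPrimitive.ae_reflect h.bound] with t ht
    rwa [norm_neg]

/-- Global existence backwards in time for Lipschitz fields. -/
theorem exists_isBoundedPrimitive_of_right [CompleteSpace X] (h : IsLipschitzField a b L M F)
    (hab : a ≤ b) (x₁ : X) : ∃ x, x b = x₁ ∧ IsBoundedPrimitive a b x (fun t => F t (x t)) := by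
  obtain ⟨x, hx, hxp⟩ := h.reflect.exists_isBoundedPrimitive hab x₁
  refine ⟨fun t => x (a + b - t), by simpa using hx, ?_⟩
  simpa using hxp.reflect hab

end IsLipschitzField

end Existence

/-! ### Truncation to a ball -/

section Retraction

variable {X : Type*} [NormedAddCommGroup X] [NormedSpace ℝ X]

/-- The radial retraction onto the closed ball of radius `R`. -/
def radialRetraction (R : ℝ) (x : X) : X := (R / max R ‖x‖) • x

theorem radialRetraction_of_norm_le {R : ℝ} (hR : 0 < R) {x : X} (hx : ‖x‖ ≤ R) :
    radialRetraction R x = x := by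
  rw [radialRetraction, max_eq_left hx, div_self hR.ne', one_smul]

theorem norm_radialRetraction_le {R : ℝ} (hR : 0 < R) (x : X) : ‖radialRetraction R x‖ ≤ R := by
  have hm : 0 < max R ‖x‖ := lt_max_of_lt_left hR
  rw [radialRetraction, norm_smul, Real.norm_of_nonneg (by positivity), div_mul_eq_mul_div,
    div_le_iff₀ hm]
  exact mul_le_mul_of_nonneg_left (le_max_right _ _) hR.le

/-- The difference splits into a rescaled `x - y` and a change of scaling factor, each of norm at
most `‖x - y‖`. The constant 2 works in any normed space. -/
theorem norm_radialRetraction_sub_le {R : ℝ} (hR : 0 < R) (x y : X) :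
    ‖radialRetraction R x - radialRetraction R y‖ ≤ 2 * ‖x - y‖ := by
  have hx : 0 < max R ‖x‖ := lt_max_of_lt_left hR
  have hy : 0 < max R ‖y‖ := lt_max_of_lt_left hR
  have e : radialRetraction R x - radialRetraction R y =
      (R / max R ‖x‖) • (x - y) + (R / max R ‖x‖ - R / max R ‖y‖) • y := by
    simp only [radialRetraction]
    module
  have h1 : ‖(R / max R ‖x‖) • (x - y)‖ ≤ ‖x - y‖ := by
    rw [norm_smul, Real.norm_of_nonneg (by positivity)]
    exact mul_le_of_le_one_left (norm_nonneg _) ((div_le_one hx).2 (le_max_left _ _))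
  have h2 : ‖(R / max R ‖x‖ - R / max R ‖y‖) • y‖ ≤ ‖x - y‖ := by
    have e2 : R / max R ‖x‖ - R / max R ‖y‖ =
        (R / max R ‖x‖) * ((max R ‖y‖ - max R ‖x‖) / max R ‖y‖) := by
      field_simp
    have h3 : |max R ‖y‖ - max R ‖x‖| ≤ ‖x - y‖ := by
      refine (abs_max_sub_max_le_max R ‖y‖ R ‖x‖).trans ?_
      rw [sub_self, abs_zero, max_eq_right (abs_nonneg _), norm_sub_rev]
      exact abs_norm_sub_norm_le y x
    rw [norm_smul, e2, norm_mul, Real.norm_of_nonneg (by positivity : 0 ≤ R / max R ‖x‖), norm_div,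
      Real.norm_of_nonneg hy.le, mul_assoc, Real.norm_eq_abs]
    refine (mul_le_of_le_one_left (by positivity) ((div_le_one hx).2 (le_max_left _ _))).trans ?_
    rw [div_mul_eq_mul_div, div_le_iff₀ hy]
    exact mul_le_mul h3 (le_max_right _ _) (norm_nonneg _) (norm_nonneg _)
  rw [e]
  refine (norm_add_le _ _).trans ?_
  linarith

end Retraction

/-! ### Pointwise consequences of the norm of `𝒢²` -/

section Component

variable {t₀ tf : ℝ} {X Y : Type} [NormedAddCommGroup X] [NormedSpace ℝ X]
  [NormedAddCommGroup Y] [NormedSpace ℝ Y]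

/-- The supremum over `x` sits inside the essential supremum, so the exceptional null set is
independent of `x`; the bound can therefore be evaluated along any trajectory. -/
theorem ComponentSpace.ae_norm_iteratedFDeriv_le {k n : ℕ} (hn : n ≤ k)
    (g : ComponentSpace t₀ tf X Y k) :
    ∀ᵐ t ∂(timeMeasure t₀ tf), ∀ x, ‖iteratedFDeriv ℝ n (g t) x‖ ≤ ‖g‖ := by
  have hfin := g.isComponent.finite.ne
  filter_upwards [ENNReal.ae_le_essSup
    (μ := timeMeasure t₀ tf) (fun t => ⨆ x : X, ‖iteratedFDeriv ℝ n (g t) x‖ₑ)] with t ht x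
  have h1 : ‖iteratedFDeriv ℝ n (g t) x‖ₑ ≤ componentENorm t₀ tf k g := by
    refine (le_iSup (fun x => ‖iteratedFDeriv ℝ n (g t) x‖ₑ) x).trans (ht.trans ?_)
    exact Finset.single_le_sum (f := fun n =>
      essSup (fun t => ⨆ x : X, ‖iteratedFDeriv ℝ n (g t) x‖ₑ) (timeMeasure t₀ tf))
      (fun _ _ => zero_le) (Finset.mem_range.2 (Nat.lt_succ_of_le hn))
  rw [← toReal_enorm]
  exact ENNReal.toReal_mono hfin h1

theorem ComponentSpace.ae_norm_le (g : ComponentSpace t₀ tf X Y 2) :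
    ∀ᵐ t ∂(timeMeasure t₀ tf), ∀ x, ‖g t x‖ ≤ ‖g‖ := by
  filter_upwards [g.ae_norm_iteratedFDeriv_le (n := 0) (by norm_num)] with t ht x
  simpa using ht x

theorem ComponentSpace.ae_norm_fderiv_le (g : ComponentSpace t₀ tf X Y 2) :
    ∀ᵐ t ∂(timeMeasure t₀ tf), ∀ x, ‖fderiv ℝ (g t) x‖ ≤ ‖g‖ := by
  filter_upwards [g.ae_norm_iteratedFDeriv_le (n := 1) (by norm_num)] with t ht x
  simpa [norm_iteratedFDeriv_one] using ht x

theorem ComponentSpace.ae_differentiable (g : ComponentSpace t₀ tf X Y 2) :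
    ∀ᵐ t ∂(timeMeasure t₀ tf), Differentiable ℝ (g t) := by
  filter_upwards [g.isComponent.contDiff] with t ht
  exact ht.differentiable (by norm_num)

theorem ComponentSpace.ae_norm_fderiv_sub_le (g : ComponentSpace t₀ tf X Y 2) :
    ∀ᵐ t ∂(timeMeasure t₀ tf), ∀ x y,
      ‖fderiv ℝ (g t) y - fderiv ℝ (g t) x‖ ≤ ‖g‖ * ‖y - x‖ := by
  filter_upwards [g.ae_norm_iteratedFDeriv_le (n := 2) (by norm_num), g.isComponent.contDiff]
    with t ht hc x y
  have hd : Differentiable ℝ (fderiv ℝ (g t)) :=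
    (hc.fderiv_right (m := 1) (by norm_num)).differentiable (by norm_num)
  refine convex_univ.norm_image_sub_le_of_norm_fderiv_le (𝕜 := ℝ) (fun z _ => hd z)
    (fun z _ => ?_) (mem_univ x) (mem_univ y)
  have := ht z
  rwa [← norm_iteratedFDeriv_fderiv, norm_iteratedFDeriv_one] at this

theorem ComponentSpace.ae_norm_sub_le (g : ComponentSpace t₀ tf X Y 2) :
    ∀ᵐ t ∂(timeMeasure t₀ tf), ∀ x y, ‖g t y - g t x‖ ≤ ‖g‖ * ‖y - x‖ := by
  filter_upwards [g.ae_norm_fderiv_le, g.ae_differentiable] with t ht hd x y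
  exact convex_univ.norm_image_sub_le_of_norm_fderiv_le (𝕜 := ℝ) (fun z _ => hd z)
    (fun z _ => ht z) (mem_univ x) (mem_univ y)

/-- Mean value inequality on the segment, where the derivative stays within `‖g‖ ‖y - x‖` of its
value at `x`. The sharp factor 1/2 is not needed. -/
theorem ComponentSpace.ae_norm_taylor_le (g : ComponentSpace t₀ tf X Y 2) :
    ∀ᵐ t ∂(timeMeasure t₀ tf), ∀ x y,
      ‖g t y - g t x - fderiv ℝ (g t) x (y - x)‖ ≤ ‖g‖ * ‖y - x‖ ^ 2 := by
  filter_upwards [g.ae_norm_fderiv_sub_le, g.ae_differentiable] with t ht hd x y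
  have := (convex_segment x y).norm_image_sub_le_of_norm_hasFDerivWithin_le'
    (f' := fderiv ℝ (g t)) (φ := fderiv ℝ (g t) x) (C := ‖g‖ * ‖y - x‖)
    (fun z _ => (hd z).hasFDerivAt.hasFDerivWithinAt) (fun z hz => ?_)
    (left_mem_segment ℝ x y) (right_mem_segment ℝ x y)
  · rwa [mul_assoc, ← sq] at this
  · refine (ht x z).trans (mul_le_mul_of_nonneg_left ?_ (norm_nonneg _))
    exact norm_sub_le_of_mem_segment hz

theorem ComponentSpace.aestronglyMeasurable_comp (g : ComponentSpace t₀ tf X Y 2) {u : ℝ → X}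
    (hu : AEStronglyMeasurable u (timeMeasure t₀ tf)) :
    AEStronglyMeasurable (fun t => g t (u t)) (timeMeasure t₀ tf) :=
  AEStronglyMeasurable.caratheodory_comp (g.ae_differentiable.mono fun _ h => h.continuous)
    g.isComponent.measurable hu

end Component

/-! ### Bounds and Taylor expansion of admissible functions -/

section Admissible

variable {t₀ tf : ℝ} {X G Y : Type} [NormedAddCommGroup X] [NormedSpace ℝ X]
  [NormedAddCommGroup G] [NormedSpace ℝ G] [NormedAddCommGroup Y] [NormedSpace ℝ Y]

namespace CaratheodoryC1Lipschitz

variable {h : ℝ → X → G → Y}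

theorem exists_lipschitz (hh : CaratheodoryC1Lipschitz t₀ tf h) {R : ℝ} (hR : 0 < R) :
    ∃ L, 0 ≤ L ∧ ∀ᵐ t ∂(timeMeasure t₀ tf), ∀ x₁ x₂ g₁ g₂,
      ‖x₁‖ ≤ R → ‖x₂‖ ≤ R → ‖g₁‖ ≤ R → ‖g₂‖ ≤ R →
      ‖h t x₁ g₁ - h t x₂ g₂‖ ≤ L * (‖x₁ - x₂‖ + ‖g₁ - g₂‖) ∧
      ‖partialX h t x₁ g₁ - partialX h t x₂ g₂‖ + ‖partialG h t x₁ g₁ - partialG h t x₂ g₂‖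
        ≤ L * (‖x₁ - x₂‖ + ‖g₁ - g₂‖) := by
  obtain ⟨L₁, h₁⟩ := hh.lipschitz R hR
  obtain ⟨L₂, h₂⟩ := hh.lipschitz_deriv R hR
  refine ⟨max 0 (max L₁ L₂), le_max_left _ _, ?_⟩
  filter_upwards [h₁, h₂] with t e₁ e₂ x₁ x₂ g₁ g₂ i₁ i₂ i₃ i₄
  refine ⟨(e₁ x₁ x₂ g₁ g₂ i₁ i₂ i₃ i₄).trans ?_, (e₂ x₁ x₂ g₁ g₂ i₁ i₂ i₃ i₄).trans ?_⟩
  · gcongr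
    exact (le_max_left _ _).trans (le_max_right _ _)
  · gcongr
    exact (le_max_right _ _).trans (le_max_right _ _)

/-- Comparison with the point `(0, g)`: the growth condition bounds the values there, and the local
Lipschitz condition carries the bounds over to `x`. -/
theorem exists_bound (hh : CaratheodoryC1Lipschitz t₀ tf h) {R : ℝ} (hR : 0 < R) :
    ∃ C, 0 ≤ C ∧ ∀ᵐ t ∂(timeMeasure t₀ tf), ∀ x g, ‖x‖ ≤ R → ‖g‖ ≤ R →
      ‖h t x g‖ ≤ C ∧ ‖partialX h t x g‖ ≤ C ∧ ‖partialG h t x g‖ ≤ C := by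
  obtain ⟨K₁, hK₁, h₁⟩ := hh.growth
  obtain ⟨K₂, hK₂, h₂⟩ := hh.growth_deriv
  obtain ⟨L, hL, h₃⟩ := hh.exists_lipschitz hR
  refine ⟨max K₁ K₂ * (R + 1) + L * R, by positivity, ?_⟩
  filter_upwards [h₁, h₂, h₃] with t e₁ e₂ e₃ x g hx hg
  obtain ⟨i₁, i₂⟩ := e₃ x 0 g g hx (by simpa using hR.le) hg hg
  rw [sub_zero, sub_self, norm_zero, add_zero] at i₁ i₂
  have j : L * ‖x‖ ≤ L * R := by gcongr
  have k₁ : K₁ * (‖g‖ + 1) ≤ max K₁ K₂ * (R + 1) := by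
    gcongr
    exact le_max_left _ _
  have k₂ : K₂ * (‖g‖ + 1) ≤ max K₁ K₂ * (R + 1) := by
    gcongr
    exact le_max_right _ _
  have n₁ := norm_sub_norm_le (h t x g) (h t 0 g)
  have n₂ := norm_sub_norm_le (partialX h t x g) (partialX h t 0 g)
  have n₃ := norm_sub_norm_le (partialG h t x g) (partialG h t 0 g)
  have p₁ := norm_nonneg (partialX h t x g - partialX h t 0 g)
  have p₂ := norm_nonneg (partialG h t x g - partialG h t 0 g)
  refine ⟨?_, ?_, ?_⟩
  · linarith [e₁ g]
  · linarith [(e₂ g).1]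
  · linarith [(e₂ g).2]

/-- Joint differentiability, composed with the two slice inclusions, identifies the partial
derivatives as the components of the full derivative. -/
theorem ae_hasFDerivAt (hh : CaratheodoryC1Lipschitz t₀ tf h) :
    ∀ᵐ t ∂(timeMeasure t₀ tf), ∀ p : X × G, HasFDerivAt (fun p : X × G => h t p.1 p.2)
      ((partialX h t p.1 p.2).coprod (partialG h t p.1 p.2)) p := by
  filter_upwards [hh.contDiff] with t ht p
  have hd := (ht.differentiable (by norm_num) p).hasFDerivAt
  have e : fderiv ℝ (fun p : X × G => h t p.1 p.2) p =
      (partialX h t p.1 p.2).coprod (partialG h t p.1 p.2) := by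
    have e₁ : partialX h t p.1 p.2 = _ :=
      (HasFDerivAt.comp p.1 (f := fun x => (x, p.2)) hd
        (hasFDerivAt_prodMk_left p.1 p.2)).fderiv
    have e₂ : partialG h t p.1 p.2 = _ :=
      (HasFDerivAt.comp p.2 (f := fun y => (p.1, y)) hd
        (hasFDerivAt_prodMk_right p.1 p.2)).fderiv
    rw [e₁, e₂]
    ext v <;> simp
  rwa [← e]

theorem exists_taylor (hh : CaratheodoryC1Lipschitz t₀ tf h) {R : ℝ} (hR : 0 < R) :
    ∃ C, 0 ≤ C ∧ ∀ᵐ t ∂(timeMeasure t₀ tf), ∀ x₁ x₂ g₁ g₂,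
      ‖x₁‖ ≤ R → ‖x₂‖ ≤ R → ‖g₁‖ ≤ R → ‖g₂‖ ≤ R →
      ‖h t x₂ g₂ - h t x₁ g₁ -
        (partialX h t x₁ g₁ (x₂ - x₁) + partialG h t x₁ g₁ (g₂ - g₁))‖
        ≤ C * (‖x₂ - x₁‖ + ‖g₂ - g₁‖) ^ 2 := by
  obtain ⟨L, hL, hl⟩ := hh.exists_lipschitz hR
  refine ⟨L * 2, by positivity, ?_⟩
  filter_upwards [hl, hh.ae_hasFDerivAt] with t ht hd x₁ x₂ g₁ g₂ i₁ i₂ i₃ i₄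
  set p : X × G := (x₁, g₁)
  set q : X × G := (x₂, g₂)
  -- The product carries the maximum norm, so the separate bounds on `x` and `g` describe one convex
  -- ball, which contains the segment.
  have hball : segment ℝ p q ⊆ Metric.closedBall 0 R := by
    refine (convex_closedBall (0 : X × G) R).segment_subset ?_ ?_ <;>
      simp [p, q, Prod.norm_def, *]
  have hn : ‖q - p‖ ≤ ‖x₂ - x₁‖ + ‖g₂ - g₁‖ := by
    rw [Prod.norm_def]
    exact max_le_add_of_nonneg (norm_nonneg _) (norm_nonneg _)
  have := (convex_segment p q).norm_image_sub_le_of_norm_hasFDerivWithin_le'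
    (f := fun p : X × G => h t p.1 p.2)
    (f' := fun p => (partialX h t p.1 p.2).coprod (partialG h t p.1 p.2))
    (φ := (partialX h t p.1 p.2).coprod (partialG h t p.1 p.2)) (C := L * (2 * ‖q - p‖))
    (fun z _ => (hd z).hasFDerivWithinAt) (fun z hz => ?_)
    (left_mem_segment ℝ p q) (right_mem_segment ℝ p q)
  · refine this.trans ?_
    have h0 := norm_nonneg (q - p)
    calc L * (2 * ‖q - p‖) * ‖q - p‖ = L * 2 * ‖q - p‖ ^ 2 := by ring
      _ ≤ _ := by gcongr
  · have hz1 := hball hz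
    rw [mem_closedBall_zero_iff, Prod.norm_def, max_le_iff] at hz1
    have hz2 : ‖z - p‖ ≤ ‖q - p‖ := norm_sub_le_of_mem_segment hz
    have hz3 := hz2
    rw [Prod.norm_def (z - p), max_le_iff] at hz3
    have e := (ht z.1 p.1 z.2 p.2 hz1.1 i₁ hz1.2 i₃).2
    -- The norm of the full derivative's increment is at most the sum of the increments of the
    -- partials, the quantity controlled by the Lipschitz hypothesis.
    refine (ContinuousLinearMap.opNorm_le_bound _ (by positivity) fun v => ?_ :
      _ ≤ ‖partialX h t z.1 z.2 - partialX h t p.1 p.2‖ +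
        ‖partialG h t z.1 z.2 - partialG h t p.1 p.2‖).trans (e.trans ?_)
    · have e1 : ((partialX h t z.1 z.2).coprod (partialG h t z.1 z.2) -
          (partialX h t p.1 p.2).coprod (partialG h t p.1 p.2)) v =
          (partialX h t z.1 z.2 - partialX h t p.1 p.2) v.1 +
          (partialG h t z.1 z.2 - partialG h t p.1 p.2) v.2 := by
        simp only [sub_apply, ContinuousLinearMap.coprod_apply]
        abel
      rw [e1, add_mul]
      refine (norm_add_le _ _).trans (add_le_add ?_ ?_)
      · exact (ContinuousLinearMap.le_opNorm _ _).trans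
          (mul_le_mul_of_nonneg_left (norm_fst_le v) (norm_nonneg _))
      · exact (ContinuousLinearMap.le_opNorm _ _).trans
          (mul_le_mul_of_nonneg_left (norm_snd_le v) (norm_nonneg _))
    · refine mul_le_mul_of_nonneg_left ?_ hL
      rw [two_mul]
      exact add_le_add hz3.1 hz3.2

end CaratheodoryC1Lipschitz

end Admissible

/-! ### Uniform estimates for `h(t, x, g(t, x))` -/

section Feedback

variable {t₀ tf : ℝ} {X G Y : Type} [NormedAddCommGroup X] [NormedSpace ℝ X]
  [NormedAddCommGroup G] [NormedSpace ℝ G] [NormedAddCommGroup Y] [NormedSpace ℝ Y]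

namespace CaratheodoryC1Lipschitz

variable {h : ℝ → X → G → Y}

theorem aestronglyMeasurable_comp (hh : CaratheodoryC1Lipschitz t₀ tf h) {u : ℝ → X} {w : ℝ → G}
    (hu : AEStronglyMeasurable u (timeMeasure t₀ tf))
    (hw : AEStronglyMeasurable w (timeMeasure t₀ tf)) :
    AEStronglyMeasurable (fun t => h t (u t) (w t)) (timeMeasure t₀ tf) :=
  AEStronglyMeasurable.caratheodory_comp (F := fun t (p : X × G) => h t p.1 p.2) hh.continuous
    (fun p => hh.measurable p.1 p.2) (hu.prodMk hw)

theorem aestronglyMeasurable_partialX (hh : CaratheodoryC1Lipschitz t₀ tf h) {u e : ℝ → X}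
    {w : ℝ → G} (hu : AEStronglyMeasurable u (timeMeasure t₀ tf))
    (hw : AEStronglyMeasurable w (timeMeasure t₀ tf))
    (he : AEStronglyMeasurable e (timeMeasure t₀ tf)) :
    AEStronglyMeasurable (fun t => partialX h t (u t) (w t) (e t)) (timeMeasure t₀ tf) := by
  refine AEStronglyMeasurable.caratheodory_fderiv (F := fun t x => h t x (w t)) ?_
    (fun x => hh.aestronglyMeasurable_comp aestronglyMeasurable_const hw) hu he
  filter_upwards [hh.contDiff] with t ht
  exact (ht.differentiable (by norm_num)).comp (differentiable_id.prodMk (differentiable_const _))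

/-- The direction may vary with time because the chain rule applies `partialG` to `fderiv ℝ (g t) (x
t) e`. -/
theorem aestronglyMeasurable_partialG (hh : CaratheodoryC1Lipschitz t₀ tf h) {u : ℝ → X}
    {w e : ℝ → G} (hu : AEStronglyMeasurable u (timeMeasure t₀ tf))
    (hw : AEStronglyMeasurable w (timeMeasure t₀ tf))
    (he : AEStronglyMeasurable e (timeMeasure t₀ tf)) :
    AEStronglyMeasurable (fun t => partialG h t (u t) (w t) (e t)) (timeMeasure t₀ tf) := by
  refine AEStronglyMeasurable.caratheodory_fderiv (F := fun t y => h t (u t) y) ?_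
    (fun x => hh.aestronglyMeasurable_comp hu aestronglyMeasurable_const) hw he
  filter_upwards [hh.contDiff] with t ht
  exact (ht.differentiable (by norm_num)).comp ((differentiable_const _).prodMk differentiable_id)

/-- Uniform estimates for `(t, x) ↦ h(t, x, g(t, x))` with `x` and `g` in bounded sets. -/
theorem exists_feedback_estimates (hh : CaratheodoryC1Lipschitz t₀ tf h) {R M : ℝ} (hR : 0 < R)
    (hM : 0 < M) :
    ∃ C, 0 ≤ C ∧ ∀ g₁ g₂ : ComponentSpace t₀ tf X G 2, ‖g₁‖ ≤ M → ‖g₂‖ ≤ M →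
      ∀ᵐ t ∂(timeMeasure t₀ tf), ∀ x y, ‖x‖ ≤ R → ‖y‖ ≤ R →
        ‖h t y (g₂ t y)‖ ≤ C ∧
        ‖h t y (g₂ t y) - h t x (g₁ t x)‖ ≤ C * (‖y - x‖ + ‖g₂ - g₁‖) ∧
        ‖h t y (g₂ t y) - h t x (g₁ t x) - (partialX h t x (g₁ t x) (y - x) +
          partialG h t x (g₁ t x) (fderiv ℝ (g₁ t) x (y - x)) +
          partialG h t x (g₁ t x) ((g₂ - g₁) t x))‖ ≤ C * (‖y - x‖ + ‖g₂ - g₁‖) ^ 2 := by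
  -- One radius covers both the states, bounded by `R`, and the values of `g₁` and `g₂`, bounded by
  -- `M`.
  have hR' : 0 < max R M := lt_max_of_lt_left hR
  obtain ⟨L, hL0, hL⟩ := hh.exists_lipschitz hR'
  obtain ⟨B, hB0, hB⟩ := hh.exists_bound hR'
  obtain ⟨T, hT0, hT⟩ := hh.exists_taylor hR'
  refine ⟨B + L * (M + 2) + (T * (M + 2) ^ 2 + B * (M + 1)), by positivity,
    fun g₁ g₂ h₁ h₂ => ?_⟩
  filter_upwards [hL, hB, hT, g₁.ae_norm_le, g₂.ae_norm_le, g₂.ae_norm_sub_le,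
    (g₂ - g₁).ae_norm_le, (g₂ - g₁).ae_norm_sub_le, g₁.ae_norm_taylor_le]
    with t hL hB hT n₁ n₂ l₂ nd ld tl x y hx hy
  set s := ‖y - x‖ + ‖g₂ - g₁‖ with hs
  have hs1 : ‖y - x‖ ≤ s := le_add_of_nonneg_right (norm_nonneg _)
  have hs2 : ‖g₂ - g₁‖ ≤ s := le_add_of_nonneg_left (norm_nonneg _)
  have hs0 : 0 ≤ s := (norm_nonneg _).trans hs1
  have hx' : ‖x‖ ≤ max R M := hx.trans (le_max_left _ _)
  have hy' : ‖y‖ ≤ max R M := hy.trans (le_max_left _ _)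
  have hg1 : ‖g₁ t x‖ ≤ max R M := ((n₁ x).trans h₁).trans (le_max_right _ _)
  have hg2 : ‖g₂ t y‖ ≤ max R M := ((n₂ y).trans h₂).trans (le_max_right _ _)
  have hgd : ‖g₂ t y - g₁ t x‖ ≤ (M + 1) * s := by
    have e : g₂ t y - g₁ t x = (g₂ t y - g₂ t x) + (g₂ - g₁) t x := by
      rw [ComponentSpace.sub_apply]; abel
    rw [e]
    calc _ ≤ ‖g₂ t y - g₂ t x‖ + ‖(g₂ - g₁) t x‖ := norm_add_le _ _
      _ ≤ ‖g₂‖ * ‖y - x‖ + ‖g₂ - g₁‖ := add_le_add (l₂ x y) (nd x)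
      _ ≤ M * s + s := by gcongr
      _ = _ := by ring
  have hsum : ‖y - x‖ + ‖g₂ t y - g₁ t x‖ ≤ (M + 2) * s := by linarith
  refine ⟨?_, ?_, ?_⟩
  · refine (hB y _ hy' hg2).1.trans ?_
    have : 0 ≤ L * (M + 2) + (T * (M + 2) ^ 2 + B * (M + 1)) := by positivity
    linarith
  · calc _ ≤ L * (‖y - x‖ + ‖g₂ t y - g₁ t x‖) := (hL y x _ _ hy' hx' hg2 hg1).1
      _ ≤ L * ((M + 2) * s) := by gcongr
      _ = (L * (M + 2)) * s := by ring
      _ ≤ _ := by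
        refine mul_le_mul_of_nonneg_right ?_ hs0
        have : 0 ≤ T * (M + 2) ^ 2 + B * (M + 1) := by positivity
        linarith
  -- Moving the perturbation `g₂ - g₁` from `y` to `x` costs `‖g₂ - g₁‖ ‖y - x‖`, which is of second
  -- order because the norm controls the derivative of the perturbation.
  · have hrem : ‖g₂ t y - g₁ t x - (fderiv ℝ (g₁ t) x (y - x) + (g₂ - g₁) t x)‖ ≤
        (M + 1) * s ^ 2 := by
      have e : g₂ t y - g₁ t x - (fderiv ℝ (g₁ t) x (y - x) + (g₂ - g₁) t x) =
          (g₁ t y - g₁ t x - fderiv ℝ (g₁ t) x (y - x)) + ((g₂ - g₁) t y - (g₂ - g₁) t x) := by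
        simp only [ComponentSpace.sub_apply]; abel
      rw [e]
      calc _ ≤ ‖g₁ t y - g₁ t x - fderiv ℝ (g₁ t) x (y - x)‖ +
            ‖(g₂ - g₁) t y - (g₂ - g₁) t x‖ := norm_add_le _ _
        _ ≤ ‖g₁‖ * ‖y - x‖ ^ 2 + ‖g₂ - g₁‖ * ‖y - x‖ := add_le_add (tl x y) (ld x y)
        _ ≤ M * s ^ 2 + s * s := by gcongr
        _ = _ := by ring
    have e : h t y (g₂ t y) - h t x (g₁ t x) - (partialX h t x (g₁ t x) (y - x) +
          partialG h t x (g₁ t x) (fderiv ℝ (g₁ t) x (y - x)) +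
          partialG h t x (g₁ t x) ((g₂ - g₁) t x)) =
        (h t y (g₂ t y) - h t x (g₁ t x) - (partialX h t x (g₁ t x) (y - x) +
          partialG h t x (g₁ t x) (g₂ t y - g₁ t x))) +
        partialG h t x (g₁ t x)
          (g₂ t y - g₁ t x - (fderiv ℝ (g₁ t) x (y - x) + (g₂ - g₁) t x)) := by
      simp only [map_sub, map_add]; abel
    rw [e]
    calc _ ≤ T * (‖y - x‖ + ‖g₂ t y - g₁ t x‖) ^ 2 + B * ((M + 1) * s ^ 2) := by
          refine (norm_add_le _ _).trans (add_le_add (hT x y _ _ hx' hy' hg1 hg2) ?_)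
          exact (ContinuousLinearMap.le_opNorm _ _).trans
            (mul_le_mul (hB x _ hx' hg1).2.2 hrem (norm_nonneg _) hB0)
      _ ≤ T * ((M + 2) * s) ^ 2 + B * ((M + 1) * s ^ 2) := by gcongr
      _ = (T * (M + 2) ^ 2 + B * (M + 1)) * s ^ 2 := by ring
      _ ≤ _ := by
        refine mul_le_mul_of_nonneg_right ?_ (sq_nonneg s)
        have : 0 ≤ B + L * (M + 2) := by positivity
        linarith

end CaratheodoryC1Lipschitz

end Feedback

/-! ### Uniqueness and stability of the state -/

section State

variable {t₀ tf : ℝ} {X G : Type} [NormedAddCommGroup X] [NormedSpace ℝ X] [CompleteSpace X]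
  [NormedAddCommGroup G] [NormedSpace ℝ G]

omit [NormedAddCommGroup G] [NormedSpace ℝ G] in
theorem IsState.isBoundedPrimitive (ht : t₀ ≤ tf) {f : ℝ → X → G → X} {x₀ : X} {g : ℝ → X → G}
    {x : ℝ → X} (h : IsState t₀ tf f x₀ g x) :
    IsBoundedPrimitive t₀ tf x (fun t => f t (x t) (g t (x t))) :=
  .of_memW1Inf ht h.memW1Inf h.ode

/-- Grönwall with zero defect, on a ball containing both trajectories; there the closed-loop field
is Lipschitz. -/
theorem IsState.eqOn (ht : t₀ ≤ tf) {f : ℝ → X → G → X} {x₀ : X}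
    (hf : CaratheodoryC1Lipschitz t₀ tf f) (g : ComponentSpace t₀ tf X G 2) {x y : ℝ → X}
    (hx : IsState t₀ tf f x₀ g x) (hy : IsState t₀ tf f x₀ g y) : EqOn x y (Icc t₀ tf) := by
  obtain ⟨R₁, hR₁, h₁⟩ := (hx.isBoundedPrimitive ht).exists_norm_le
  obtain ⟨R₂, hR₂, h₂⟩ := (hy.isBoundedPrimitive ht).exists_norm_le
  obtain ⟨C, hC0, hC⟩ := hf.exists_feedback_estimates (R := max R₁ R₂) (M := ‖g‖ + 1)
    (by positivity) (by positivity)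
  intro t htm
  have := (hx.isBoundedPrimitive ht).norm_sub_le (hy.isBoundedPrimitive ht)
    (hx.initial.trans hy.initial.symm) hC0 le_rfl (by
      filter_upwards [hC g g (by linarith) (by linarith), ae_restrict_mem measurableSet_Ioo]
        with t e hmem
      have := (e (y t) (x t) ((h₂ t (Ioo_subset_Icc_self hmem)).trans (le_max_right _ _))
        ((h₁ t (Ioo_subset_Icc_self hmem)).trans (le_max_left _ _))).2.1
      simpa using this) t htm
  rw [zero_mul] at this
  exact sub_eq_zero.1 (norm_le_zero_iff.1 this)

/-- Near `gε`, the state equation is solvable with a solution depending on `g` in a Lipschitz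
way. -/
theorem IsState.exists_near (ht : t₀ ≤ tf) {f : ℝ → X → G → X} {x₀ : X}
    (hf : CaratheodoryC1Lipschitz t₀ tf f) (gε : ComponentSpace t₀ tf X G 2) {xε : ℝ → X}
    (hxε : IsState t₀ tf f x₀ gε xε) :
    ∃ R > 0, ∃ C ≥ 0, ∀ᶠ g : ComponentSpace t₀ tf X G 2 in 𝓝 gε, ‖g‖ ≤ ‖gε‖ + 1 ∧
      ∃ x, IsState t₀ tf f x₀ g x ∧
      ∀ t ∈ Icc t₀ tf, ‖xε t‖ ≤ R ∧ ‖x t‖ ≤ R ∧ ‖x t - xε t‖ ≤ C * ‖g - gε‖ := by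
  have hpε := hxε.isBoundedPrimitive ht
  obtain ⟨R₀, hR₀, hbε⟩ := hpε.exists_norm_le
  -- The margin of one around `xε` leaves room for nearby trajectories.
  set R := R₀ + 1 with hRdef
  have hR : 0 < R := by positivity
  obtain ⟨K, hK0, hK⟩ := hf.exists_feedback_estimates (R := R) (M := ‖gε‖ + 1) hR (by positivity)
  have hΓ : 0 ≤ gronwallBound 0 (2 * K) 1 (tf - t₀) := by
    have := gronwallBound_mono (δ := 0) (K := 2 * K) (ε := 1) le_rfl zero_le_one (by positivity)
      (sub_nonneg.2 ht)
    rwa [gronwallBound_x0] at this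
  set C := K * gronwallBound 0 (2 * K) 1 (tf - t₀) with hCdef
  have hC0 : 0 ≤ C := mul_nonneg hK0 hΓ
  refine ⟨R, hR, C, hC0, ?_⟩
  -- The radius 1 keeps `‖g‖` in the range where `K` is valid; `1 / (C + 1)` keeps the deviation of
  -- the state below the margin.
  have hδ : 0 < min 1 (1 / (C + 1)) := by positivity
  filter_upwards [Metric.closedBall_mem_nhds gε hδ] with g hg
  rw [mem_closedBall_iff_norm, le_min_iff] at hg
  have hgn : ‖g‖ ≤ ‖gε‖ + 1 := by
    have := norm_sub_norm_le g gε
    linarith [hg.1]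
  refine ⟨hgn, ?_⟩
  -- Retracting the state makes the field globally Lipschitz; the 2 is the Lipschitz constant of the
  -- retraction.
  have hF : IsLipschitzField t₀ tf (2 * K) K
      (fun t x => f t (radialRetraction R x) (g t (radialRetraction R x))) := by
    refine ⟨fun x => hf.aestronglyMeasurable_comp aestronglyMeasurable_const
      (g.isComponent.measurable _), by positivity, ?_, ?_⟩
    · filter_upwards [hK g g hgn hgn] with t e x y
      refine (e _ _ (norm_radialRetraction_le hR y) (norm_radialRetraction_le hR x)).2.1.trans ?_
      rw [sub_self, norm_zero, add_zero]
      calc _ ≤ K * (2 * ‖x - y‖) :=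
            mul_le_mul_of_nonneg_left (norm_radialRetraction_sub_le hR x y) hK0
        _ = _ := by ring
    · filter_upwards [hK g g hgn hgn] with t e
      exact (e _ _ (norm_radialRetraction_le hR 0) (norm_radialRetraction_le hR 0)).1
  obtain ⟨x, hx0, hxp⟩ := hF.exists_isBoundedPrimitive ht x₀
  have hclose : ∀ t ∈ Icc t₀ tf, ‖x t - xε t‖ ≤ C * ‖g - gε‖ := by
    intro t htm
    have := hxp.norm_sub_le hpε (hx0.trans hxε.initial.symm) (K := 2 * K) (c := K * ‖g - gε‖)
      (by positivity) (by positivity) (by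
        filter_upwards [hK gε g (by linarith) hgn, ae_restrict_mem measurableSet_Ioo]
          with t e hmem
        have hb : ‖xε t‖ ≤ R := (hbε t (Ioo_subset_Icc_self hmem)).trans (by linarith)
        refine (e (xε t) _ hb (norm_radialRetraction_le hR (x t))).2.1.trans ?_
        have h1 := norm_radialRetraction_sub_le hR (x t) (xε t)
        -- The retraction fixes `xε`, so `xε` can be compared with the truncated solution before the
        -- latter is known to stay in the ball.
        rw [radialRetraction_of_norm_le hR hb] at h1
        have h2 := mul_le_mul_of_nonneg_left h1 hK0
        linarith) t htm
    refine this.trans (le_of_eq ?_)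
    rw [hCdef]
    ring
  have hle : ∀ t ∈ Icc t₀ tf, ‖x t‖ ≤ R := by
    intro t htm
    have h1 := norm_sub_norm_le (x t) (xε t)
    have h2 : C * ‖g - gε‖ ≤ 1 := by
      have h3 : C * ‖g - gε‖ ≤ C * (1 / (C + 1)) := mul_le_mul_of_nonneg_left hg.2 hC0
      refine h3.trans ?_
      rw [mul_one_div, div_le_one (by positivity)]
      linarith
    linarith [hclose t htm, hbε t htm]
  refine ⟨x, ⟨hxp.memW1Inf ht, hx0, ?_⟩, fun t htm =>
    ⟨(hbε t htm).trans (by linarith), hle t htm, hclose t htm⟩⟩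
  filter_upwards [hxp.ae_hasDerivAt ht, ae_restrict_mem measurableSet_Ioo] with t hd hmem
  rwa [radialRetraction_of_norm_le hR (hle t (Ioo_subset_Icc_self hmem))] at hd

end State

/-! ### Product rule for inner products -/

section ProductRule

variable {a b : ℝ} {X : Type} [NormedAddCommGroup X] [InnerProductSpace ℝ X] [CompleteSpace X]

/-- The product rule for inner products of Lipschitz functions. -/
theorem IsBoundedPrimitive.innerProduct (hab : a ≤ b) {x y v w : ℝ → X} (hx : IsBoundedPrimitive a b x v)
    (hy : IsBoundedPrimitive a b y w) :
    IsBoundedPrimitive a b (fun t => inner ℝ (x t) (y t))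
      (fun t => inner ℝ (x t) (w t) + inner ℝ (v t) (y t)) := by
  obtain ⟨Rx, hRx, hbx⟩ := hx.exists_norm_le
  obtain ⟨Ry, hRy, hby⟩ := hy.exists_norm_le
  obtain ⟨Lx, hLx0, hLx⟩ := hx.exists_lipschitz
  obtain ⟨Ly, hLy0, hLy⟩ := hy.exists_lipschitz
  obtain ⟨Mx, hMx0, hMx⟩ := hx.bound_nonneg
  obtain ⟨My, hMy0, hMy⟩ := hy.bound_nonneg
  -- Bounded Lipschitz factors have a Lipschitz product, which is therefore recovered from its a.e.
  -- derivative.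
  refine .of_ae_hasDerivAt hab (absolutelyContinuousOnInterval hab
    ⟨Rx * Ly + Lx * Ry, by positivity, fun s hs t ht => ?_⟩) ?_ ?_ ⟨Rx * My + Mx * Ry, ?_⟩
  · have e : inner ℝ (x t) (y t) - inner ℝ (x s) (y s) =
        inner ℝ (x t) (y t - y s) + inner ℝ (x t - x s) (y s) := by
      rw [inner_sub_right, inner_sub_left]; ring
    rw [e, add_mul]
    refine (norm_add_le _ _).trans (add_le_add ?_ ?_)
    · refine (norm_inner_le_norm _ _).trans ?_
      rw [mul_assoc]
      exact mul_le_mul (hbx t ht) (hLy s hs t ht) (norm_nonneg _) hRx.le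
    · refine (norm_inner_le_norm _ _).trans ?_
      rw [mul_right_comm]
      exact mul_le_mul (hLx s hs t ht) (hby s hs) (norm_nonneg _) (by positivity)
  · filter_upwards [hx.ae_hasDerivAt hab, hy.ae_hasDerivAt hab] with t h₁ h₂
    exact h₁.inner ℝ h₂
  · exact (hx.continuousOn.aestronglyMeasurable_timeMeasure.inner hy.aestronglyMeasurable).add
      (hx.aestronglyMeasurable.inner hy.continuousOn.aestronglyMeasurable_timeMeasure)
  · filter_upwards [hMx, hMy, ae_restrict_mem measurableSet_Ioo] with t h₁ h₂ hmem
    have ht := Ioo_subset_Icc_self hmem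
    refine (norm_add_le _ _).trans (add_le_add ?_ ?_)
    · exact (norm_inner_le_norm _ _).trans (mul_le_mul (hbx t ht) h₂ (norm_nonneg _) hRx.le)
    · exact (norm_inner_le_norm _ _).trans (mul_le_mul h₁ (hby t ht) (norm_nonneg _) hMx0)

end ProductRule

/-! ### Gradients and adjoints through their pairings -/

section Gradients

variable {X G : Type} [NormedAddCommGroup X] [InnerProductSpace ℝ X] [CompleteSpace X]
  [NormedAddCommGroup G] [InnerProductSpace ℝ G] [CompleteSpace G]
  {f : ℝ → X → G → X} {l : ℝ → X → G → ℝ} {g : ℝ → X → G} {x : ℝ → X} {t : ℝ}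

/-- The weight `Bᵀp + ∇_g l` of the model error in the derivative of the quantity of interest. -/
def errorWeight (f : ℝ → X → G → X) (l : ℝ → X → G → ℝ) (g : ℝ → X → G) (x p : ℝ → X) (t : ℝ) : G :=
  (linB f g x t).adjoint (p t) + gradGl l g x t

/-- The right-hand side of the adjoint equation. -/
def adjointField (f : ℝ → X → G → X) (l : ℝ → X → G → ℝ) (g : ℝ → X → G) (x : ℝ → X) (t : ℝ)
    (p : X) : X :=
  -((linA f g x t).adjoint p + gradXl l g x t + (fderiv ℝ (g t) (x t)).adjoint (gradGl l g x t))

theorem inner_gradient (φ : X → ℝ) (x e : X) : inner ℝ (gradient φ x) e = fderiv ℝ φ x e := by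
  rw [gradient, InnerProductSpace.toDual_symm_apply]

theorem norm_gradient (φ : X → ℝ) (x : X) : ‖gradient φ x‖ = ‖fderiv ℝ φ x‖ := by
  rw [gradient, LinearIsometryEquiv.norm_map]

omit [NormedAddCommGroup G] [InnerProductSpace ℝ G] [CompleteSpace G] in
theorem inner_gradXl (e : X) :
    inner ℝ (gradXl l g x t) e = partialX l t (x t) (g t (x t)) e := inner_gradient _ _ _

omit [NormedAddCommGroup X] [InnerProductSpace ℝ X] [CompleteSpace X] in
theorem inner_gradGl (e : G) :
    inner ℝ (gradGl l g x t) e = partialG l t (x t) (g t (x t)) e := inner_gradient _ _ _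

theorem inner_errorWeight (p : ℝ → X) (e : G) :
    inner ℝ (errorWeight f l g x p t) e =
      inner ℝ (p t) (partialG f t (x t) (g t (x t)) e) + partialG l t (x t) (g t (x t)) e := by
  rw [errorWeight, inner_add_left, ContinuousLinearMap.adjoint_inner_left, inner_gradGl, linB]

/-- Pairing removes the adjoint operators and leaves the same partial derivatives as in the Taylor
expansion of the feedback, ready for cancellation. -/
theorem inner_adjointField (p e : X) :
    inner ℝ (adjointField f l g x t p) e =
      -(inner ℝ p (partialX f t (x t) (g t (x t)) e +
          partialG f t (x t) (g t (x t)) (fderiv ℝ (g t) (x t) e)) +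
        partialX l t (x t) (g t (x t)) e +
        partialG l t (x t) (g t (x t)) (fderiv ℝ (g t) (x t) e)) := by
  rw [adjointField, inner_neg_left, inner_add_left, inner_add_left,
    ContinuousLinearMap.adjoint_inner_left, ContinuousLinearMap.adjoint_inner_left, inner_gradXl,
    inner_gradGl, linA]
  rfl

end Gradients

/-! ### Solvability of the adjoint equation -/

section Adjoint

variable {t₀ tf : ℝ} {X G : Type} [NormedAddCommGroup X] [InnerProductSpace ℝ X] [CompleteSpace X]
  [NormedAddCommGroup G] [InnerProductSpace ℝ G] [CompleteSpace G]
  {f : ℝ → X → G → X} {l : ℝ → X → G → ℝ} {x : ℝ → X}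

theorem exists_coefficient_bound (hf : CaratheodoryC1Lipschitz t₀ tf f)
    (hl : CaratheodoryC1Lipschitz t₀ tf l) (g : ComponentSpace t₀ tf X G 2)
    (hx : ∃ R, 0 < R ∧ ∀ t ∈ Icc t₀ tf, ‖x t‖ ≤ R) :
    ∃ C, 0 ≤ C ∧ ∀ᵐ t ∂(timeMeasure t₀ tf), ‖linA f g x t‖ ≤ C ∧ ‖linB f g x t‖ ≤ C ∧
      ‖gradXl l g x t‖ ≤ C ∧ ‖gradGl l g x t‖ ≤ C ∧ ‖fderiv ℝ (g t) (x t)‖ ≤ C := by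
  obtain ⟨R, hR, hx⟩ := hx
  obtain ⟨C₁, hC₁, h₁⟩ := hf.exists_bound (R := max R (‖g‖ + 1)) (by positivity)
  obtain ⟨C₂, hC₂, h₂⟩ := hl.exists_bound (R := max R (‖g‖ + 1)) (by positivity)
  refine ⟨C₁ + C₁ * ‖g‖ + C₂ + ‖g‖, by positivity, ?_⟩
  filter_upwards [h₁, h₂, g.ae_norm_le, g.ae_norm_fderiv_le, ae_restrict_mem measurableSet_Ioo]
    with t h₁ h₂ n n' hmem
  have hxR : ‖x t‖ ≤ max R (‖g‖ + 1) := (hx t (Ioo_subset_Icc_self hmem)).trans (le_max_left _ _)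
  have hgR : ‖g t (x t)‖ ≤ max R (‖g‖ + 1) := by
    refine le_trans ?_ (le_max_right _ _)
    linarith [n (x t)]
  obtain ⟨-, a₁, b₁⟩ := h₁ _ _ hxR hgR
  obtain ⟨-, a₂, b₂⟩ := h₂ _ _ hxR hgR
  have hp : 0 ≤ C₁ * ‖g‖ := by positivity
  have hg0 := norm_nonneg g
  refine ⟨?_, ?_, ?_, ?_, ?_⟩
  · have : ‖linA f g x t‖ ≤ C₁ + C₁ * ‖g‖ := by
      refine (norm_add_le _ _).trans (add_le_add a₁ ?_)
      exact (ContinuousLinearMap.opNorm_comp_le _ _).trans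
        (mul_le_mul b₁ (n' _) (norm_nonneg _) hC₁)
    linarith
  · rw [linB]; linarith
  · rw [gradXl, norm_gradient]
    change ‖partialX l t (x t) (g t (x t))‖ ≤ _
    linarith
  · rw [gradGl, norm_gradient]
    change ‖partialG l t (x t) (g t (x t))‖ ≤ _
    linarith
  · linarith [n' (x t)]

variable [FiniteDimensional ℝ X]

/-- The field is affine in `p`, so a bound for `A` along the bounded trajectory is a global
Lipschitz constant and no truncation is needed. -/
theorem exists_isLipschitzField_adjointField (hf : CaratheodoryC1Lipschitz t₀ tf f)
    (hl : CaratheodoryC1Lipschitz t₀ tf l) (g : ComponentSpace t₀ tf X G 2)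
    (hx : ContinuousOn x (Icc t₀ tf)) (hxb : ∃ R, 0 < R ∧ ∀ t ∈ Icc t₀ tf, ‖x t‖ ≤ R) :
    ∃ L M, IsLipschitzField t₀ tf L M (adjointField f l g x) := by
  obtain ⟨C, hC0, hC⟩ := exists_coefficient_bound hf hl g hxb
  refine ⟨C, C + C * C, fun p => ?_, hC0, ?_, ?_⟩
  · have mx := hx.aestronglyMeasurable_timeMeasure
    have mg := g.aestronglyMeasurable_comp mx
    refine aestronglyMeasurable_of_inner fun e => ?_
    have me : AEStronglyMeasurable (fun _ : ℝ => e) (timeMeasure t₀ tf) :=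
      aestronglyMeasurable_const
    have mge : AEStronglyMeasurable (fun t => fderiv ℝ (g t) (x t) e) (timeMeasure t₀ tf) :=
      AEStronglyMeasurable.caratheodory_fderiv g.ae_differentiable g.isComponent.measurable mx me
    simp only [real_inner_comm _ e, inner_adjointField]
    exact (((((hf.aestronglyMeasurable_partialX mx mg me).add
      (hf.aestronglyMeasurable_partialG mx mg mge)).const_inner).add
      (hl.aestronglyMeasurable_partialX mx mg me)).add
      (hl.aestronglyMeasurable_partialG mx mg mge)).neg
  · filter_upwards [hC] with t h p q
    have e : adjointField f l g x t p - adjointField f l g x t q =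
        (linA f g x t).adjoint (q - p) := by
      rw [adjointField, adjointField, map_sub]; abel
    rw [e, norm_sub_rev p q]
    refine (ContinuousLinearMap.le_opNorm _ _).trans ?_
    rw [LinearIsometryEquiv.norm_map]
    exact mul_le_mul_of_nonneg_right h.1 (norm_nonneg _)
  · filter_upwards [hC] with t h
    rw [adjointField, map_zero, zero_add, norm_neg]
    refine (norm_add_le _ _).trans (add_le_add h.2.2.1 ?_)
    refine (ContinuousLinearMap.le_opNorm _ _).trans ?_
    rw [LinearIsometryEquiv.norm_map]
    exact mul_le_mul h.2.2.2.2 h.2.2.2.1 (norm_nonneg _) hC0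

variable {φ : X → ℝ}

omit [FiniteDimensional ℝ X] in
theorem IsAdjoint.isBoundedPrimitive {g : ℝ → X → G} {p : ℝ → X} (ht : t₀ ≤ tf)
    (h : IsAdjoint t₀ tf f φ l g x p) :
    IsBoundedPrimitive t₀ tf p (fun t => adjointField f l g x t (p t)) :=
  .of_memW1Inf ht h.memW1Inf h.ode

theorem exists_isAdjoint (ht : t₀ ≤ tf) (hf : CaratheodoryC1Lipschitz t₀ tf f)
    (hl : CaratheodoryC1Lipschitz t₀ tf l) (g : ComponentSpace t₀ tf X G 2)
    (hx : ContinuousOn x (Icc t₀ tf)) (hxb : ∃ R, 0 < R ∧ ∀ t ∈ Icc t₀ tf, ‖x t‖ ≤ R) :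
    ∃ p, IsAdjoint t₀ tf f φ l g x p := by
  obtain ⟨L, M, hF⟩ := exists_isLipschitzField_adjointField hf hl g hx hxb
  obtain ⟨p, hp, hpp⟩ := hF.exists_isBoundedPrimitive_of_right ht (gradient φ (x tf))
  exact ⟨p, hpp.memW1Inf ht, hp, hpp.ae_hasDerivAt ht⟩

theorem IsAdjoint.eqOn (ht : t₀ ≤ tf) (hf : CaratheodoryC1Lipschitz t₀ tf f)
    (hl : CaratheodoryC1Lipschitz t₀ tf l) (g : ComponentSpace t₀ tf X G 2)
    (hx : ContinuousOn x (Icc t₀ tf)) (hxb : ∃ R, 0 < R ∧ ∀ t ∈ Icc t₀ tf, ‖x t‖ ≤ R)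
    {p r : ℝ → X} (hp : IsAdjoint t₀ tf f φ l g x p) (hr : IsAdjoint t₀ tf f φ l g x r) :
    EqOn p r (Icc t₀ tf) := by
  obtain ⟨L, M, hF⟩ := exists_isLipschitzField_adjointField hf hl g hx hxb
  intro t htm
  have := (hp.isBoundedPrimitive ht).norm_sub_le_of_right ht (hr.isBoundedPrimitive ht)
    (hp.terminal.trans hr.terminal.symm) hF.nonneg le_rfl (by
      filter_upwards [hF.lipschitz] with t e
      simpa using e (p t) (r t)) t htm
  rw [zero_mul] at this
  exact sub_eq_zero.1 (norm_le_zero_iff.1 this)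

omit [FiniteDimensional ℝ X] in
theorem exists_errorWeight_bound (hf : CaratheodoryC1Lipschitz t₀ tf f)
    (hl : CaratheodoryC1Lipschitz t₀ tf l) (g : ComponentSpace t₀ tf X G 2)
    (hxb : ∃ R, 0 < R ∧ ∀ t ∈ Icc t₀ tf, ‖x t‖ ≤ R) {p : ℝ → X}
    (hpb : ∃ R, 0 < R ∧ ∀ t ∈ Icc t₀ tf, ‖p t‖ ≤ R) :
    ∃ C, 0 ≤ C ∧ ∀ᵐ t ∂(timeMeasure t₀ tf), ‖errorWeight f l g x p t‖ ≤ C := by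
  obtain ⟨C, hC0, hC⟩ := exists_coefficient_bound hf hl g hxb
  obtain ⟨P, hP, hp⟩ := hpb
  refine ⟨C * P + C, by positivity, ?_⟩
  filter_upwards [hC, ae_restrict_mem measurableSet_Ioo] with t h hmem
  refine (norm_add_le _ _).trans (add_le_add ?_ h.2.2.2.1)
  refine (ContinuousLinearMap.le_opNorm _ _).trans ?_
  rw [LinearIsometryEquiv.norm_map]
  exact mul_le_mul h.2.1 (hp t (Ioo_subset_Icc_self hmem)) (norm_nonneg _) hC0

omit [FiniteDimensional ℝ X] in
theorem aestronglyMeasurable_errorWeight [FiniteDimensional ℝ G]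
    (hf : CaratheodoryC1Lipschitz t₀ tf f)
    (hl : CaratheodoryC1Lipschitz t₀ tf l) (g : ComponentSpace t₀ tf X G 2)
    (hx : ContinuousOn x (Icc t₀ tf)) {p : ℝ → X} (hp : ContinuousOn p (Icc t₀ tf)) :
    AEStronglyMeasurable (errorWeight f l g x p) (timeMeasure t₀ tf) := by
  have mx := hx.aestronglyMeasurable_timeMeasure
  have mg := g.aestronglyMeasurable_comp mx
  refine aestronglyMeasurable_of_inner fun e => ?_
  have me : AEStronglyMeasurable (fun _ : ℝ => e) (timeMeasure t₀ tf) :=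
    aestronglyMeasurable_const
  simp only [real_inner_comm _ e, inner_errorWeight]
  exact (hp.aestronglyMeasurable_timeMeasure.inner (hf.aestronglyMeasurable_partialG mx mg me)).add
    (hl.aestronglyMeasurable_partialG mx mg me)

end Adjoint

/-! ### Independence of the chosen state -/

section ReducedQoI

variable {t₀ tf : ℝ} {X G : Type} [NormedAddCommGroup X] [NormedSpace ℝ X] [CompleteSpace X]
  [NormedAddCommGroup G] [NormedSpace ℝ G]

/-- By uniqueness the chosen solution agrees with any given one on the closed interval, and the
quantity of interest sees nothing else. -/
theorem reducedQoI_eq_qoi (ht : t₀ ≤ tf) {f : ℝ → X → G → X} {x₀ : X}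
    (hf : CaratheodoryC1Lipschitz t₀ tf f) (φ : X → ℝ) (l : ℝ → X → G → ℝ)
    (g : ComponentSpace t₀ tf X G 2) {x : ℝ → X} (hx : IsState t₀ tf f x₀ g x) :
    reducedQoI t₀ tf f x₀ φ l g = qoi t₀ tf φ l x g := by
  have hex : ∃ x, IsState t₀ tf f x₀ g x := ⟨x, hx⟩
  have hs : IsState t₀ tf f x₀ g (stateSolution t₀ tf f x₀ g) := by
    rw [stateSolution, dif_pos hex]
    exact hex.choose_spec
  have he := hs.eqOn ht hf g hx
  rw [reducedQoI, qoi, qoi, he (right_mem_Icc.2 ht)]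
  congr 1
  refine intervalIntegral.integral_congr fun t htm => ?_
  rw [uIcc_of_le ht] at htm
  simp only [he htm]

end ReducedQoI

/-! ### Fréchet derivative by the adjoint identity -/

section Derivative

variable {t₀ tf : ℝ} {X G : Type} [NormedAddCommGroup X] [InnerProductSpace ℝ X]
  [NormedAddCommGroup G] [InnerProductSpace ℝ G]

theorem aestronglyMeasurable_inner_component {x : ℝ → X} (hx : ContinuousOn x (Icc t₀ tf))
    {w : ℝ → G} (hw : AEStronglyMeasurable w (timeMeasure t₀ tf))
    (δ : ComponentSpace t₀ tf X G 2) :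
    AEStronglyMeasurable (fun t => inner ℝ (w t) (δ t (x t))) (timeMeasure t₀ tf) :=
  hw.inner (δ.aestronglyMeasurable_comp hx.aestronglyMeasurable_timeMeasure)

theorem ae_norm_inner_component_le (x : ℝ → X) {w : ℝ → G} {C : ℝ} (hC0 : 0 ≤ C)
    (hC : ∀ᵐ t ∂(timeMeasure t₀ tf), ‖w t‖ ≤ C) (δ : ComponentSpace t₀ tf X G 2) :
    ∀ᵐ t ∂(timeMeasure t₀ tf), ‖inner ℝ (w t) (δ t (x t))‖ ≤ C * ‖δ‖ := by
  filter_upwards [hC, δ.ae_norm_le] with t h₁ h₂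
  exact (norm_inner_le_norm _ _).trans (mul_le_mul h₁ (h₂ _) (norm_nonneg _) hC0)

/-- A bounded weight along a trajectory defines a continuous functional on component functions. -/
theorem exists_weightedFunctional (ht : t₀ ≤ tf) {x : ℝ → X} (hx : ContinuousOn x (Icc t₀ tf))
    {w : ℝ → G} (hw : AEStronglyMeasurable w (timeMeasure t₀ tf)) {C : ℝ} (hC0 : 0 ≤ C)
    (hC : ∀ᵐ t ∂(timeMeasure t₀ tf), ‖w t‖ ≤ C) :
    ∃ D : ComponentSpace t₀ tf X G 2 →L[ℝ] ℝ,
      ∀ δ, D δ = ∫ t in t₀..tf, inner ℝ (w t) (δ t (x t)) := by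
  have hi : ∀ δ : ComponentSpace t₀ tf X G 2,
      IntervalIntegrable (fun t => inner ℝ (w t) (δ t (x t))) volume t₀ tf := fun δ =>
    intervalIntegrable_of_ae_bound ht (aestronglyMeasurable_inner_component hx hw δ)
      (ae_norm_inner_component_le x hC0 hC δ)
  let D : ComponentSpace t₀ tf X G 2 →ₗ[ℝ] ℝ :=
    { toFun := fun δ => ∫ t in t₀..tf, inner ℝ (w t) (δ t (x t))
      map_add' := fun δ η => by
        rw [← intervalIntegral.integral_add (hi δ) (hi η)]
        simp only [ComponentSpace.add_apply, inner_add_right]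
      map_smul' := fun c δ => by
        rw [RingHom.id_apply, smul_eq_mul, ← intervalIntegral.integral_const_mul]
        refine intervalIntegral.integral_congr fun t _ => ?_
        exact real_inner_smul_right _ _ _ }
  refine ⟨D.mkContinuous (C * |tf - t₀|) fun δ => ?_, fun δ => rfl⟩
  refine (norm_integral_le_of_ae_bound (ae_norm_inner_component_le x hC0 hC δ)
    (left_mem_Icc.2 ht) (right_mem_Icc.2 ht)).trans (le_of_eq ?_)
  ring

variable [CompleteSpace X] [CompleteSpace G] [FiniteDimensional ℝ G]

/-- The adjoint representation of the derivative of the reduced quantity of interest. -/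
theorem exists_hasFDerivAt_reducedQoI (ht : t₀ ≤ tf) {f : ℝ → X → G → X} {l : ℝ → X → G → ℝ}
    {φ : X → ℝ} {x₀ : X} (hf : CaratheodoryC1Lipschitz t₀ tf f)
    (hl : CaratheodoryC1Lipschitz t₀ tf l) (hφ : ContDiff ℝ 1 φ)
    (gε : ComponentSpace t₀ tf X G 2) {xε p : ℝ → X} (hxε : IsState t₀ tf f x₀ gε xε)
    (hp : IsAdjoint t₀ tf f φ l gε xε p) :
    ∃ D : ComponentSpace t₀ tf X G 2 →L[ℝ] ℝ,
      HasFDerivAt (reducedQoI t₀ tf f x₀ φ l) D gε ∧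
      ∀ δ, D δ = ∫ t in t₀..tf, inner ℝ (errorWeight f l gε xε p t) (δ t (xε t)) := by
  have hxp := hxε.isBoundedPrimitive ht
  have hpp := hp.isBoundedPrimitive ht
  obtain ⟨W, hW0, hW⟩ := exists_errorWeight_bound hf hl gε hxp.exists_norm_le hpp.exists_norm_le
  have mw := aestronglyMeasurable_errorWeight hf hl gε hxp.continuousOn hpp.continuousOn
  obtain ⟨D, hD⟩ := exists_weightedFunctional ht hxp.continuousOn mw hW0 hW
  refine ⟨D, ?_, hD⟩
  obtain ⟨R, hR, C, hC0, hnear⟩ := IsState.exists_near ht hf gε hxε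
  obtain ⟨Kf, hKf0, hKf⟩ := hf.exists_feedback_estimates (R := R) (M := ‖gε‖ + 1) hR (by positivity)
  obtain ⟨Kl, hKl0, hKl⟩ := hl.exists_feedback_estimates (R := R) (M := ‖gε‖ + 1) hR (by positivity)
  obtain ⟨P, hP0, hP⟩ := hpp.exists_norm_le
  have hl_int : ∀ (g : ComponentSpace t₀ tf X G 2) (x : ℝ → X), ‖g‖ ≤ ‖gε‖ + 1 →
      ContinuousOn x (Icc t₀ tf) → (∀ t ∈ Icc t₀ tf, ‖x t‖ ≤ R) →
      IntervalIntegrable (fun t => l t (x t) (g t (x t))) volume t₀ tf := by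
    intro g x hg hx hxR
    have mx := hx.aestronglyMeasurable_timeMeasure
    refine intervalIntegrable_of_ae_bound (M := Kl) ht
      (hl.aestronglyMeasurable_comp mx (g.aestronglyMeasurable_comp mx)) ?_
    filter_upwards [hKl g g hg hg, ae_restrict_mem measurableSet_Ioo] with t e hmem
    have hb := hxR t (Ioo_subset_Icc_self hmem)
    exact (e _ _ hb hb).1
  have hgε : ‖gε‖ ≤ ‖gε‖ + 1 := by linarith
  set Q := (P * Kf + Kl) * (C + 1) ^ 2 * |tf - t₀| with hQ
  have hQ0 : 0 ≤ Q := by positivity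
  -- The Taylor remainder of `φ` is split off: `φ` is only `C¹`, so that remainder is merely `o(‖g -
  -- gε‖)`, while everything else is quadratic.
  have key : ∀ (g : ComponentSpace t₀ tf X G 2) (x : ℝ → X), ‖g‖ ≤ ‖gε‖ + 1 →
      IsState t₀ tf f x₀ g x →
      (∀ t ∈ Icc t₀ tf, ‖xε t‖ ≤ R ∧ ‖x t‖ ≤ R ∧ ‖x t - xε t‖ ≤ C * ‖g - gε‖) →
      ‖reducedQoI t₀ tf f x₀ φ l g - reducedQoI t₀ tf f x₀ φ l gε - D (g - gε) -
        (φ (x tf) - φ (xε tf) - fderiv ℝ φ (xε tf) (x tf - xε tf))‖ ≤ Q * ‖g - gε‖ ^ 2 := by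
    intro g x hg hx hb
    have hgp := hx.isBoundedPrimitive ht
    have hprod := hpp.innerProduct ht (hgp.sub hxp)
    have hI₁ := hl_int g x hg hgp.continuousOn fun t htm => (hb t htm).2.1
    have hI₂ := hl_int gε xε hgε hxp.continuousOn fun t htm => (hb t htm).1
    have hI₃ := hprod.intervalIntegrable (left_mem_Icc.2 ht) (right_mem_Icc.2 ht)
    have hI₄ := intervalIntegrable_of_ae_bound ht
      (aestronglyMeasurable_inner_component hxp.continuousOn mw (g - gε))
      (ae_norm_inner_component_le xε hW0 hW (g - gε))
    -- The boundary term at `t₀` vanishes as the states agree there; the terminal condition turns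
    -- the one at `tf` into the derivative of `φ`.
    have hend := hprod.eq_integral tf (right_mem_Icc.2 ht)
    simp only [hx.initial, hxε.initial, sub_self, inner_zero_right, zero_add] at hend
    rw [hp.terminal, inner_gradient] at hend
    have e : reducedQoI t₀ tf f x₀ φ l g - reducedQoI t₀ tf f x₀ φ l gε - D (g - gε) -
        (φ (x tf) - φ (xε tf) - fderiv ℝ φ (xε tf) (x tf - xε tf)) =
        ∫ t in t₀..tf, ((l t (x t) (g t (x t)) - l t (xε t) (gε t (xε t)) +
          (inner ℝ (p t) (f t (x t) (g t (x t)) - f t (xε t) (gε t (xε t))) +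
            inner ℝ (adjointField f l gε xε t (p t)) (x t - xε t))) -
          inner ℝ (errorWeight f l gε xε p t) ((g - gε) t (xε t))) := by
      rw [intervalIntegral.integral_sub ((hI₁.sub hI₂).add hI₃) hI₄,
        intervalIntegral.integral_add (hI₁.sub hI₂) hI₃, intervalIntegral.integral_sub hI₁ hI₂,
        ← hend, hD, reducedQoI_eq_qoi ht hf φ l g hx, reducedQoI_eq_qoi ht hf φ l gε hxε, qoi, qoi]
      ring
    rw [e]
    have hbound : ∀ᵐ t ∂(timeMeasure t₀ tf),
        ‖(l t (x t) (g t (x t)) - l t (xε t) (gε t (xε t)) +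
          (inner ℝ (p t) (f t (x t) (g t (x t)) - f t (xε t) (gε t (xε t))) +
            inner ℝ (adjointField f l gε xε t (p t)) (x t - xε t))) -
          inner ℝ (errorWeight f l gε xε p t) ((g - gε) t (xε t))‖ ≤
        (P * Kf + Kl) * (C + 1) ^ 2 * ‖g - gε‖ ^ 2 := by
      filter_upwards [hKf gε g hgε hg, hKl gε g hgε hg, ae_restrict_mem measurableSet_Ioo]
        with t ef el hmem
      have htm := Ioo_subset_Icc_self hmem
      obtain ⟨b₁, b₂, b₃⟩ := hb t htm
      obtain ⟨-, -, rf⟩ := ef _ _ b₁ b₂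
      obtain ⟨-, -, rl⟩ := el _ _ b₁ b₂
      set ρf := f t (x t) (g t (x t)) - f t (xε t) (gε t (xε t)) -
        (partialX f t (xε t) (gε t (xε t)) (x t - xε t) +
          partialG f t (xε t) (gε t (xε t)) (fderiv ℝ (gε t) (xε t) (x t - xε t)) +
          partialG f t (xε t) (gε t (xε t)) ((g - gε) t (xε t))) with hρf
      set ρl := l t (x t) (g t (x t)) - l t (xε t) (gε t (xε t)) -
        (partialX l t (xε t) (gε t (xε t)) (x t - xε t) +
          partialG l t (xε t) (gε t (xε t)) (fderiv ℝ (gε t) (xε t) (x t - xε t)) +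
          partialG l t (xε t) (gε t (xε t)) ((g - gε) t (xε t))) with hρl
      -- All first-order terms cancel: the adjoint field removes those in `x - xε`, the error weight
      -- those in `g - gε`.
      have hsplit : (l t (x t) (g t (x t)) - l t (xε t) (gε t (xε t)) +
          (inner ℝ (p t) (f t (x t) (g t (x t)) - f t (xε t) (gε t (xε t))) +
            inner ℝ (adjointField f l gε xε t (p t)) (x t - xε t))) -
          inner ℝ (errorWeight f l gε xε p t) ((g - gε) t (xε t)) =
          inner ℝ (p t) ρf + ρl := by
        rw [inner_adjointField, inner_errorWeight, hρf, hρl]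
        simp only [inner_sub_right, inner_add_right]
        ring
      rw [hsplit]
      have hs : ‖x t - xε t‖ + ‖g - gε‖ ≤ (C + 1) * ‖g - gε‖ := by linarith
      calc _ ≤ P * (Kf * (‖x t - xε t‖ + ‖g - gε‖) ^ 2) +
            Kl * (‖x t - xε t‖ + ‖g - gε‖) ^ 2 := by
            refine (norm_add_le _ _).trans (add_le_add ?_ rl)
            exact (norm_inner_le_norm _ _).trans
              (mul_le_mul (hP t htm) rf (norm_nonneg _) hP0.le)
        _ ≤ P * (Kf * ((C + 1) * ‖g - gε‖) ^ 2) + Kl * ((C + 1) * ‖g - gε‖) ^ 2 := by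
            gcongr
        _ = _ := by ring
    refine (norm_integral_le_of_ae_bound hbound (left_mem_Icc.2 ht)
      (right_mem_Icc.2 ht)).trans (le_of_eq ?_)
    rw [hQ]
    ring
  rw [hasFDerivAt_iff_isLittleOTVS, Asymptotics.isLittleOTVS_iff_isLittleO,
    Asymptotics.isLittleO_iff]
  intro c hc
  have hφd := (hφ.differentiable (by norm_num) (xε tf)).hasFDerivAt.isLittleO
  rw [Asymptotics.isLittleO_iff] at hφd
  obtain ⟨η, hη, hφη⟩ := Metric.eventually_nhds_iff_ball.1
    (hφd (show 0 < c / (2 * (C + 1)) by positivity))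
  -- The first radius puts `x tf` within `η` of `xε tf`; the second makes the quadratic term at most
  -- `c / 2` times `‖g - gε‖`. The remainder of `φ` takes the other half.
  have hr : 0 < min (η / (C + 1)) (c / (2 * (Q + 1))) := by positivity
  filter_upwards [hnear, Metric.ball_mem_nhds gε hr] with g ⟨hg, x, hx, hb⟩ hball
  rw [mem_ball_iff_norm, lt_min_iff, lt_div_iff₀ (by positivity), lt_div_iff₀ (by positivity)]
    at hball
  have hd0 := norm_nonneg (g - gε)
  have hclose := (hb tf (right_mem_Icc.2 ht)).2.2
  have hφb := hφη (x tf) (by rw [mem_ball_iff_norm]; nlinarith)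
  have h₁ : c / (2 * (C + 1)) * ‖x tf - xε tf‖ ≤ c / 2 * ‖g - gε‖ := by
    calc _ ≤ c / (2 * (C + 1)) * ((C + 1) * ‖g - gε‖) := by
          gcongr
          linarith
      _ = _ := by field_simp
  have h₂ : Q * ‖g - gε‖ ^ 2 ≤ c / 2 * ‖g - gε‖ := by
    rw [sq, ← mul_assoc]
    refine mul_le_mul_of_nonneg_right ?_ hd0
    linarith [hball.2]
  have h₃ := key g x hg hx hb
  have h₄ := norm_le_insert' (reducedQoI t₀ tf f x₀ φ l g - reducedQoI t₀ tf f x₀ φ l gε -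
    D (g - gε)) (φ (x tf) - φ (xε tf) - fderiv ℝ φ (xε tf) (x tf - xε tf))
  linarith

end Derivative

end

/-! ### The main theorem -/

theorem theorem3p5 {nx ng : ℕ} (t₀ tf : ℝ) (ht : t₀ < tf)
    (f : ℝ → EuclideanSpace ℝ (Fin nx) → EuclideanSpace ℝ (Fin ng) → EuclideanSpace ℝ (Fin nx))
    (x₀ : EuclideanSpace ℝ (Fin nx))
    (φ : EuclideanSpace ℝ (Fin nx) → ℝ)
    (l : ℝ → EuclideanSpace ℝ (Fin nx) → EuclideanSpace ℝ (Fin ng) → ℝ)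
    (hf : CaratheodoryC1Lipschitz t₀ tf f)
    (hl : CaratheodoryC1Lipschitz t₀ tf l)
    (hφ : ContDiff ℝ 1 φ)
    (gε gstar : ComponentSpace t₀ tf (EuclideanSpace ℝ (Fin nx)) (EuclideanSpace ℝ (Fin ng)) 2)
    (xε : ℝ → EuclideanSpace ℝ (Fin nx))
    (hxε : IsState t₀ tf f x₀ gε xε)
    (ε : ℝ → EuclideanSpace ℝ (Fin nx) → EuclideanSpace ℝ (Fin ng))
    (hεL : MemLp (fun t => ε t (xε t)) ∞ (timeMeasure t₀ tf))
    (hε : ∀ᵐ t ∂(timeMeasure t₀ tf), ∀ i : Fin ng,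
      |gε t (xε t) i - gstar t (xε t) i| ≤ ε t (xε t) i) :
    -- the state equation is uniquely solvable for all `g` near `gε`
    (∀ᶠ g : ComponentSpace t₀ tf (EuclideanSpace ℝ (Fin nx)) (EuclideanSpace ℝ (Fin ng)) 2 in 𝓝 gε,
      (∃ x, IsState t₀ tf f x₀ g x) ∧
      ∀ x y, IsState t₀ tf f x₀ g x → IsState t₀ tf f x₀ g y → EqOn x y (Icc t₀ tf)) ∧
    DifferentiableAt ℝ (reducedQoI t₀ tf f x₀ φ l) gε ∧
    -- the adjoint equation is uniquely solvable
    (∃ p, IsAdjoint t₀ tf f φ l gε xε p) ∧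
    (∀ p r, IsAdjoint t₀ tf f φ l gε xε p → IsAdjoint t₀ tf f φ l gε xε r →
      EqOn p r (Icc t₀ tf)) ∧
    -- the error bound
    ∀ p, IsAdjoint t₀ tf f φ l gε xε p →
      IntervalIntegrable (fun t => ∑ i : Fin ng,
        |((linB f gε xε t).adjoint (p t) + gradGl l gε xε t) i| * ε t (xε t) i) volume t₀ tf ∧
      |fderiv ℝ (reducedQoI t₀ tf f x₀ φ l) gε (gε - gstar)| ≤
        ∫ t in t₀..tf, ∑ i : Fin ng,
          |((linB f gε xε t).adjoint (p t) + gradGl l gε xε t) i| * ε t (xε t) i := by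
  have hxp := hxε.isBoundedPrimitive ht.le
  refine ⟨?_, ?_, exists_isAdjoint ht.le hf hl gε hxp.continuousOn hxp.exists_norm_le,
    fun p r hp hr => IsAdjoint.eqOn ht.le hf hl gε hxp.continuousOn hxp.exists_norm_le hp hr, ?_⟩
  · obtain ⟨R, -, C, -, hnear⟩ := IsState.exists_near ht.le hf gε hxε
    filter_upwards [hnear] with g hg
    exact ⟨⟨_, hg.2.choose_spec.1⟩, fun x y hx hy => hx.eqOn ht.le hf g hy⟩
  -- Differentiability rests on the adjoint representation, so an adjoint solution has to be
  -- produced first.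
  · obtain ⟨p, hp⟩ := exists_isAdjoint (φ := φ) ht.le hf hl gε hxp.continuousOn hxp.exists_norm_le
    obtain ⟨D, hD, -⟩ := exists_hasFDerivAt_reducedQoI ht.le hf hl hφ gε hxε hp
    exact hD.differentiableAt
  · intro p hp
    have hpp := hp.isBoundedPrimitive ht.le
    obtain ⟨D, hD, hDδ⟩ := exists_hasFDerivAt_reducedQoI ht.le hf hl hφ gε hxε hp
    obtain ⟨W, hW0, hW⟩ := exists_errorWeight_bound hf hl gε hxp.exists_norm_le hpp.exists_norm_le
    have mw := aestronglyMeasurable_errorWeight hf hl gε hxp.continuousOn hpp.continuousOn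
    change IntervalIntegrable (fun t => ∑ i : Fin ng,
        |errorWeight f l gε xε p t i| * ε t (xε t) i) volume t₀ tf ∧
      _ ≤ ∫ t in t₀..tf, ∑ i : Fin ng, |errorWeight f l gε xε p t i| * ε t (xε t) i
    obtain ⟨E, hE⟩ : ∃ E, ∀ᵐ t ∂(timeMeasure t₀ tf), ‖ε t (xε t)‖ ≤ E := by
      have hlt : eLpNormEssSup (fun t => ε t (xε t)) (timeMeasure t₀ tf) < ∞ := by
        simpa using hεL.2
      refine ⟨(eLpNormEssSup (fun t => ε t (xε t)) (timeMeasure t₀ tf)).toReal, ?_⟩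
      filter_upwards [ae_le_eLpNormEssSup (f := fun t => ε t (xε t)) (μ := timeMeasure t₀ tf)]
        with t ht
      rw [← toReal_enorm]
      exact ENNReal.toReal_mono hlt.ne ht
    have coord : ∀ {v : ℝ → EuclideanSpace ℝ (Fin ng)},
        AEStronglyMeasurable v (timeMeasure t₀ tf) → ∀ i,
        AEStronglyMeasurable (fun t => v t i) (timeMeasure t₀ tf) := fun hv i =>
      (EuclideanSpace.proj (𝕜 := ℝ) i).continuous.comp_aestronglyMeasurable hv
    have hint : IntervalIntegrable (fun t => ∑ i : Fin ng,
        |errorWeight f l gε xε p t i| * ε t (xε t) i) volume t₀ tf := by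
      refine intervalIntegrable_of_ae_bound (M := ∑ i : Fin ng, W * E) ht.le
        (Finset.aestronglyMeasurable_fun_sum _ fun i _ =>
          (coord mw i).norm.mul (coord hεL.1 i)) ?_
      filter_upwards [hW, hE] with t h₁ h₂
      refine norm_sum_le_of_le _ fun i _ => ?_
      rw [norm_mul, Real.norm_eq_abs, abs_abs, ← Real.norm_eq_abs]
      exact mul_le_mul ((PiLp.norm_apply_le _ i).trans h₁) ((PiLp.norm_apply_le _ i).trans h₂)
        (norm_nonneg _) hW0
    refine ⟨hint, ?_⟩
    rw [hD.fderiv, hDδ, ← Real.norm_eq_abs]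
    refine intervalIntegral.norm_integral_le_of_norm_le ht.le ?_ hint
    filter_upwards [ae_timeMeasure_iff.1 hε] with t h hmem
    -- In coordinates each term is a product of reals, so the componentwise error bound applies
    -- without Cauchy–Schwarz across components.
    rw [PiLp.inner_apply]
    refine norm_sum_le_of_le _ fun i _ => ?_
    refine (norm_inner_le_norm _ _).trans ?_
    exact mul_le_mul_of_nonneg_left (h hmem i) (abs_nonneg _)
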